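/- Notation. Let $n,m\ge 0$ be integers, $\mathbb T^n=\mathbb R^n/\mathbb Z^n$, identified with $Q_n=[-\tfrac12,\tfrac12)^n$, and let $X$ be $\mathbb T^n$ or $\mathbb T^n\times\mathbb R^m$ with Lebesgue measure. A weight on $X$ is a measurable function with values in $(0,\infty)$ almost everywhere. For $1\le p<\infty$ and a weight $w$, $L^p_w(X)$ is the space of measurable $f$ with $\|f\|_{L^p_w}=\|f w^{1/p}\|_{L^p(X)}<\infty$, and $g$ is in weak $L^1_w(X)$ if $g$ is measurable and there is $C<\infty$ with $\int_{\{|g|>\lambda\}}w\le C/\lambda$ for all $\lambda>0$. For measurable $g$ on $\mathbb R^d$ put $$\mathcal M_{1/2}g(x)=\sup_{0<r\le 1/2}\frac1{|B(x,r)|}\int_{B(x,r)}|g(y)|\,dy\in[0,\infty],$$ with Euclidean balls $B(x,r)$. For measurable $f:\mathbb T^n\to\mathbb C$ let $f^*$ be the corresponding $1$-periodic function on $\mathbb R^n$ and $\mathcal M^Tf(x)=\mathcal M_{1/2}f^*(x)$ for $x\in Q_n$; for measurable $f:\mathbb T^n\times\mathbb R^m\to\mathbb C$ let $f^*$ be the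 corresponding function on $\mathbb R^{n+m}$, $1$-periodic in each of the first $n$ variables, and $\mathcal M^{WG}f(x,y)=\mathcal M_{1/2}f^*(x,y)$ for $(x,y)\in Q_n\times\mathbb R^m$. A function is in $L^q_{loc}(X)$ if it is in $L^q(K)$ for every compact $K\subset X$. Proposition 3.3. Let $1<p<\infty$ and $\frac1p+\frac1{p'}=1$. (i) Let $v$ be a weight on $\mathbb T^n$. Then $v^{-1/p}\in L^{p'}(\mathbb T^n)$ if and only if there is a weight $u$ on $\mathbb T^n$ such that $\mathcal M^T$ maps $L^p_v(\mathbb T^n)$ into $L^p_u(\mathbb T^n)$ with $\|\mathcal M^Tf\|_{L^p_u}\le C\|f\|_{L^p_v}$ for all $f\in L^p_v(\mathbb T^n)$, where $C<\infty$ does not depend on $f$. Moreover $v^{-1}\in L^\infty(\mathbb T^n)$ if and only if there is a weight $u$ on $\mathbb T^n$ such that $\mathcal M^T$ maps $L^1_v(\mathbb T^n)$ into weak $L^1_u(\mathbb T^n)$. The last equivalence holds both when "maps into" means only that $\mathcal M^Tf$ is in weak $L^1_u$ for every $f\in L^1_v$, and when it means the weak type bound: $\mathcal M^Tf$ is measurable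 and $\int_{\{\mathcal M^Tf>\lambda\}}u\le\frac C\lambda\|f\|_{L^1_v}$ for all $f\in L^1_v$ and $\lambda>0$, with $C<\infty$ independent of $f$ and $\lambda$. (ii) Let $v$ be a weight on $\mathbb T^n\times\mathbb R^m$. Then $v^{-1/p}\in L^{p'}_{loc}(\mathbb T^n\times\mathbb R^m)$ if and only if there is a weight $u$ on $\mathbb T^n\times\mathbb R^m$ such that $\mathcal M^{WG}$ maps $L^p_v(\mathbb T^n\times\mathbb R^m)$ into $L^p_u(\mathbb T^n\times\mathbb R^m)$ with $\|\mathcal M^{WG}f\|_{L^p_u}\le C\|f\|_{L^p_v}$ for all $f\in L^p_v(\mathbb T^n\times\mathbb R^m)$, where $C<\infty$ does not depend on $f$. Moreover $v^{-1}\in L^\infty_{loc}(\mathbb T^n\times\mathbb R^m)$ if and only if there is a weight $u$ on $\mathbb T^n\times\mathbb R^m$ such that $\mathcal M^{WG}$ maps $L^1_v(\mathbb T^n\times\mathbb R^m)$ into weak $L^1_u(\mathbb T^n\times\mathbb R^m)$, again in either of the two senses described in (i). -/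

import Mathlib

open MeasureTheory Set
open scoped ENNReal NNReal

/-- A (strictly positive) weight: a measurable function with values in `(0, ∞)`, up to null sets. -/
def IsPosWeight {X : Type*} [MeasureSpace X] (w : X → ℝ) : Prop :=
  AEMeasurable w volume ∧ ∀ᵐ x, 0 < w x

/-- The norm `‖g‖_{L^p_w} = ‖g w^{1/p}‖_{L^p} = (∫ |g|^p w)^{1/p}`, as an extended nonnegative number,
for `g` with values in `ℂ` or in `[0, ∞]`. -/
noncomputable def weightedNorm {X ε : Type*} [MeasureSpace X] [ENorm ε]
    (p : ℝ) (w : X → ℝ) (g : X → ε) : ℝ≥0∞ :=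
  (∫⁻ x, ‖g x‖ₑ ^ p * ENNReal.ofReal (w x)) ^ (1 / p)

/-- Membership in the weighted Lebesgue space `L^p_w`. -/
def MemWeightedLp {X ε : Type*} [MeasureSpace X] [TopologicalSpace ε] [ENorm ε]
    (p : ℝ) (w : X → ℝ) (g : X → ε) : Prop :=
  AEStronglyMeasurable g volume ∧ weightedNorm p w g < ∞

/-- The `w`-measure `∫_{|g| > t} w` of the superlevel set `{|g| > t}`. -/
noncomputable def weightedDistrib {X ε : Type*} [MeasureSpace X] [ENorm ε]
    (w : X → ℝ) (g : X → ε) (t : ℝ≥0) : ℝ≥0∞ :=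
  ∫⁻ x in {x | (t : ℝ≥0∞) < ‖g x‖ₑ}, ENNReal.ofReal (w x)

/-- Membership in the weighted space weak `L^1_w`. -/
def MemWeightedWeakL1 {X ε : Type*} [MeasureSpace X] [TopologicalSpace ε] [ENorm ε]
    (w : X → ℝ) (g : X → ε) : Prop :=
  AEStronglyMeasurable g volume ∧
    ∃ C : ℝ≥0, ∀ t : ℝ≥0, 0 < t → weightedDistrib w g t ≤ C / t

/-- Membership in `L^q_loc`: `f` is in `L^q(K)` for every compact `K`. -/
def MemLocLp {X : Type*} [TopologicalSpace X] [MeasureSpace X] (f : X → ℝ) (q : ℝ≥0∞) : Prop :=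
  ∀ K : Set X, IsCompact K → MemLp f q (volume.restrict K)

/-- `T` maps `L^p_v` into `L^p_u` with the norm inequality `‖T f‖_{L^p_u} ≤ C ‖f‖_{L^p_v}`,
the constant `C` being independent of `f`. -/
def MapsStrong {X : Type*} [MeasureSpace X] (T : (X → ℂ) → X → ℝ≥0∞)
    (p : ℝ) (v u : X → ℝ) : Prop :=
  ∃ C : ℝ≥0, ∀ f : X → ℂ, MemWeightedLp p v f →
    MemWeightedLp p u (T f) ∧ weightedNorm p u (T f) ≤ C * weightedNorm p v f

/-- `T` maps `L^1_v` into weak `L^1_u`, as a statement about the spaces only. -/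
def MapsIntoWeak {X : Type*} [MeasureSpace X] (T : (X → ℂ) → X → ℝ≥0∞) (v u : X → ℝ) : Prop :=
  ∀ f : X → ℂ, MemWeightedLp 1 v f → MemWeightedWeakL1 u (T f)

/-- `T` maps `L^1_v` into weak `L^1_u` boundedly:
`u({|T f| > t}) ≤ C ‖f‖_{L^1_v} / t` with `C` independent of `f` and `t`. -/
def MapsWeakBounded {X : Type*} [MeasureSpace X] (T : (X → ℂ) → X → ℝ≥0∞) (v u : X → ℝ) : Prop :=
  ∃ C : ℝ≥0, ∀ f : X → ℂ, MemWeightedLp 1 v f →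
    AEStronglyMeasurable (T f) volume ∧
      ∀ t : ℝ≥0, 0 < t → weightedDistrib u (T f) t ≤ C * weightedNorm 1 v f / t

/-- The local Hardy-Littlewood maximal operator on Euclidean space:
the supremum over `0 < r ≤ R` of the averages of `|g|` over the Euclidean ball `B(x, r)`. -/
noncomputable def localMaximal {ι : Type*} [Fintype ι] (R : ℝ) (g : EuclideanSpace ℝ ι → ℂ)
    (x : EuclideanSpace ℝ ι) : ℝ≥0∞ :=
  ⨆ r ∈ Ioc (0 : ℝ) R,
    (volume (Metric.ball x r))⁻¹ * ∫⁻ y in Metric.ball x r, ‖g y‖ₑ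

/-- The representative in `[-1/2, 1/2)` of a point of the circle `ℝ/ℤ`. -/
noncomputable def circleRep (x : UnitAddCircle) : ℝ :=
  (AddCircle.equivIco (1 : ℝ) (-1 / 2) x : ℝ)

/-- The `1`-periodic function on `ℝⁿ` corresponding to a function on the torus `ℝⁿ/ℤⁿ`. -/
def torusPeriodize {n : ℕ} (f : UnitAddTorus (Fin n) → ℂ) (x : EuclideanSpace ℝ (Fin n)) : ℂ :=
  f (fun i => (x i : UnitAddCircle))

/-- The maximal operator on the torus, `M^T f (x) = M_{1/2} f^* (x)` for `x ∈ [-1/2, 1/2)ⁿ`. -/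
noncomputable def torusMaximal (n : ℕ) (f : UnitAddTorus (Fin n) → ℂ)
    (x : UnitAddTorus (Fin n)) : ℝ≥0∞ :=
  localMaximal (1 / 2) (torusPeriodize f) (WithLp.toLp 2 fun i => circleRep (x i))

/-- The waveguide manifold `𝕋ⁿ × ℝᵐ`, with the product measure. -/
abbrev Waveguide (n m : ℕ) : Type := UnitAddTorus (Fin n) × EuclideanSpace ℝ (Fin m)

/-- The function on `ℝ^{n+m}`, `1`-periodic in the first `n` variables, corresponding to a
function on the waveguide manifold. -/
def waveguidePeriodize {n m : ℕ} (f : Waveguide n m → ℂ)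
    (z : EuclideanSpace ℝ (Fin n ⊕ Fin m)) : ℂ :=
  f (fun i => (z (Sum.inl i) : UnitAddCircle), WithLp.toLp 2 fun j => z (Sum.inr j))

/-- The maximal operator on the waveguide manifold, `M^{WG} f (x, y) = M_{1/2} f^* (x, y)` for
`(x, y) ∈ [-1/2, 1/2)ⁿ × ℝᵐ`, where `M_{1/2}` is taken on `ℝ^{n+m}`. -/
noncomputable def waveguideMaximal (n m : ℕ) (f : Waveguide n m → ℂ) (z : Waveguide n m) : ℝ≥0∞ :=
  localMaximal (1 / 2) (waveguidePeriodize f)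
    (WithLp.toLp 2 (Sum.elim (fun i => circleRep (z.1 i)) fun j => z.2 j))

/-! Balls of radius at most 1/2 centred in a fundamental domain stay in a slab `region` of Euclidean
space that covers the base at most 2^n times, so integrals over the base and over the slab are
comparable. `EuclideanCover` abstracts this; torus and waveguide are two instances of one argument.

Let σ = v^(-1/(p-1)), so that (v^(-1/p))^p' = σ and σ^(1-p) = v.

Sufficiency, p > 1: with μ = σ dz, the average of |f| over a ball B is (σ(B)/|B|) times the
μ-average of |f|/σ. Hence Mf ≤ (1 + Mσ) M_μ(|f|/σ). The centred maximal operator M_μ is bounded on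
L^p(μ) for every locally finite μ, by Besicovitch rather than doubling, and ∫ (|f|/σ)^p σ = ∫ |f|^p
v. So u = σ/(1 + Mσ)^p works; it is positive a.e. because Mσ is finite a.e. when σ is locally
integrable.

Sufficiency, p = 1: if 1/v is locally bounded, a positive u can be chosen whose supremum over any
admissible ball is at most the essential infimum of v there. The same Besicovitch domination then
gives the weak type bound.

Necessity: on a set U of small diameter, Mf is at least a constant times ∫_U |f|. For p > 1, testing
on truncations of σ bounds ∫_U σ. For p = 1, if 1/v were unbounded on U, some f in L^1_v would have
∫_U |f| = ∞, so Mf = ∞ on U, which no positive u allows. Finitely many such U cover a compact set.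
-/

/-! ### Besicovitch covering and the centred maximal theorem for general measures. -/

/-- Besicovitch domination: if every point of `A` is the centre of a ball of radius at most `R`
on which `μ` is smaller than `ν`, then `μ A` is at most a dimensional constant times the total
mass of `ν`. -/
theorem exists_measure_le_of_forall_ball_lt (E : Type*) [NormedAddCommGroup E]
    [NormedSpace ℝ E] [FiniteDimensional ℝ E] [MeasurableSpace E] [BorelSpace E] :
    ∃ N : ℕ, ∀ (R : ℝ) (μ ν : Measure E) (A : Set E),
      (∀ x ∈ A, ∃ r ∈ Ioc 0 R, μ (Metric.ball x r) < ν (Metric.ball x r)) →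
        μ A ≤ N * ν univ := by
  obtain ⟨N, τ, hτ, hN⟩ := HasBesicovitchCovering.no_satelliteConfig (α := E)
  refine ⟨N, fun R μ ν A hA => ?_⟩
  -- The covering theorem needs closed balls; the strict inequality on the open ball survives a
  -- small shrinking of the radius.
  have hclosed : ∀ x : A, ∃ r ∈ Ioc 0 R,
      μ (Metric.closedBall (x : E) r) ≤ ν (Metric.closedBall (x : E) r) := by
    rintro ⟨x, hx⟩
    obtain ⟨r, hr, hlt⟩ := hA x hx
    obtain ⟨s, hs_mono, hs_mem, hs_lim⟩ := exists_seq_strictMono_tendsto' hr.1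
    have hU : ⋃ n, Metric.closedBall x (s n) = Metric.ball x r := by
      ext y
      simp only [mem_iUnion, Metric.mem_closedBall, Metric.mem_ball]
      refine ⟨fun ⟨n, hn⟩ => hn.trans_lt (hs_mem n).2, fun h => ?_⟩
      obtain ⟨n, hn⟩ := (hs_lim.eventually (lt_mem_nhds h)).exists
      exact ⟨n, hn.le⟩
    have hmono : Monotone fun n => Metric.closedBall x (s n) :=
      fun i j hij => Metric.closedBall_subset_closedBall (hs_mono.monotone hij)
    rw [← hU, hmono.measure_iUnion (μ := ν)] at hlt
    obtain ⟨n, hn⟩ := lt_iSup_iff.1 hlt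
    refine ⟨s n, ⟨(hs_mem n).1, (hs_mem n).2.le.trans hr.2⟩, le_trans ?_ hn.le⟩
    exact measure_mono (subset_iUnion (fun n => Metric.closedBall x (s n)) n)
  choose r hr hle using hclosed
  obtain ⟨s, hdisj, hcov⟩ := Besicovitch.exist_disjoint_covering_families hτ hN
    (β := A) ⟨fun x => x, r, fun x => (hr x).1, R, fun x => (hr x).2⟩
  have hcount : ∀ i, (s i).Countable := fun i => by
    refine (hdisj i).countable_of_nonempty_interior fun x _ => ?_
    exact ⟨x, Metric.ball_subset_interior_closedBall (Metric.mem_ball_self (hr x).1)⟩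
  calc μ A ≤ μ (⋃ i, ⋃ j ∈ s i, Metric.closedBall (j : E) (r j)) := by
        refine measure_mono fun x hx => ?_
        have := hcov ⟨⟨x, hx⟩, rfl⟩
        simp only [mem_iUnion] at this ⊢
        obtain ⟨i, j, hj, hxj⟩ := this
        exact ⟨i, j, hj, Metric.ball_subset_closedBall hxj⟩
    _ ≤ ∑ i, μ (⋃ j ∈ s i, Metric.closedBall (j : E) (r j)) := measure_iUnion_fintype_le _ _
    _ ≤ ∑ _i : Fin N, ν univ := by
        refine Finset.sum_le_sum fun i _ => ?_
        calc μ (⋃ j ∈ s i, Metric.closedBall (j : E) (r j))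
            ≤ ∑' j : s i, μ (Metric.closedBall ((j : A) : E) (r j)) :=
              measure_biUnion_le μ (hcount i) _
          _ ≤ ∑' j : s i, ν (Metric.closedBall ((j : A) : E) (r j)) :=
              ENNReal.tsum_le_tsum fun j => hle j
          _ = ν (⋃ j ∈ s i, Metric.closedBall (j : E) (r j)) :=
              (measure_biUnion (hcount i) (hdisj i)
                fun _ _ => Metric.isClosed_closedBall.measurableSet).symm
          _ ≤ ν univ := measure_mono (subset_univ _)
    _ = N * ν univ := by simp

/-- The weak type estimate behind the centred maximal theorem. -/
theorem measure_lt_le_of_lt_average {E : Type*} [NormedAddCommGroup E]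
    [NormedSpace ℝ E] [FiniteDimensional ℝ E] [MeasurableSpace E] [BorelSpace E] {N : ℕ}
    (hN : ∀ (R : ℝ) (μ ν : Measure E) (A : Set E),
      (∀ x ∈ A, ∃ r ∈ Ioc 0 R, μ (Metric.ball x r) < ν (Metric.ball x r)) → μ A ≤ N * ν univ)
    {R : ℝ} {μ : Measure E} [IsLocallyFiniteMeasure μ] {g : E → ℝ} {G : E → ℝ≥0∞}
    (hg : Measurable g)
    (hG : ∀ x, ∀ t : ℝ≥0, t < G x → ∃ r ∈ Ioc 0 R,
        t * μ (Metric.ball x r) < ∫⁻ y in Metric.ball x r, ENNReal.ofReal (g y) ∂μ)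
    {t : ℝ} (ht : 0 < t) :
    μ {x | ENNReal.ofReal t < G x} ≤
      N * (ENNReal.ofReal (2 / t) *
        (μ.withDensity fun x => ENNReal.ofReal (g x)) {x | t < 2 * g x}) := by
  have hS : MeasurableSet {x | t < 2 * g x} := measurableSet_lt measurable_const (hg.const_mul 2)
  refine (hN R μ (ENNReal.ofReal (2 / t) •
    (μ.withDensity fun x => ENNReal.ofReal (g x)).restrict {x | t < 2 * g x}) _ ?_).trans ?_
  · intro x hx
    obtain ⟨r, hr, hlt⟩ := hG x t.toNNReal hx
    refine ⟨r, hr, ?_⟩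
    by_contra! hcon
    refine hlt.not_ge ?_
    have hB : MeasurableSet (Metric.ball x r) := Metric.isOpen_ball.measurableSet
    simp only [Measure.smul_apply, smul_eq_mul, Measure.restrict_apply hB] at hcon
    rw [withDensity_apply _ (hB.inter hS)] at hcon
    -- If the domination failed on this ball, the parts of the integral above and below the height g
    -- = t/2 would each be at most (t/2) μ(B), contradicting an average exceeding t.
    have h2 : ∫⁻ y in Metric.ball x r ∩ {x | t < 2 * g x}, ENNReal.ofReal (g y) ∂μ
        ≤ ENNReal.ofReal (t / 2) * μ (Metric.ball x r) := by
      calc _ = ENNReal.ofReal (t / 2) * (ENNReal.ofReal (2 / t) *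
            ∫⁻ y in Metric.ball x r ∩ {x | t < 2 * g x}, ENNReal.ofReal (g y) ∂μ) := by
            rw [← mul_assoc, ← ENNReal.ofReal_mul (by positivity),
              show t / 2 * (2 / t) = 1 by field_simp, ENNReal.ofReal_one, one_mul]
        _ ≤ _ := by gcongr
    rw [← lintegral_inter_add_sdiff _ _ hS]
    have h3 : ∫⁻ y in Metric.ball x r \ {x | t < 2 * g x}, ENNReal.ofReal (g y) ∂μ
        ≤ ENNReal.ofReal (t / 2) * μ (Metric.ball x r) := by
      calc _ ≤ ∫⁻ y in Metric.ball x r \ {x | t < 2 * g x}, ENNReal.ofReal (t / 2) ∂μ := by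
            refine setLIntegral_mono measurable_const fun y hy => ENNReal.ofReal_le_ofReal ?_
            have := hy.2
            simp only [mem_ofPred_eq, not_lt] at this
            linarith
        _ = ENNReal.ofReal (t / 2) * μ (Metric.ball x r \ {x | t < 2 * g x}) := by simp
        _ ≤ _ := by gcongr; exact sdiff_subset
    calc _ ≤ _ := add_le_add h2 h3
      _ = ENNReal.ofReal t * μ (Metric.ball x r) := by
        rw [← add_mul, ← ENNReal.ofReal_add (by positivity) (by positivity), add_halves]
  · simp [Measure.smul_apply]

/-- The centred maximal theorem for a locally finite measure, for a measurable function `G`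
dominated by the centred maximal function of `g`. -/
theorem exists_lintegral_rpow_le_of_lt_average (E : Type*) [NormedAddCommGroup E]
    [NormedSpace ℝ E] [FiniteDimensional ℝ E] [MeasurableSpace E] [BorelSpace E]
    {p : ℝ} (hp : 1 < p) :
    ∃ C : ℝ≥0, ∀ (R : ℝ) (μ : Measure E) [IsLocallyFiniteMeasure μ] (g : E → ℝ) (G : E → ℝ≥0∞),
      Measurable g → (∀ x, 0 ≤ g x) → Measurable G →
      (∀ x, ∀ t : ℝ≥0, t < G x → ∃ r ∈ Ioc 0 R,
        t * μ (Metric.ball x r) < ∫⁻ y in Metric.ball x r, ENNReal.ofReal (g y) ∂μ) →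
      ∫⁻ x, G x ^ p ∂μ ≤ C * ∫⁻ x, ENNReal.ofReal (g x) ^ p ∂μ := by
  obtain ⟨N, hN⟩ := exists_measure_le_of_forall_ball_lt E
  have hp1 : 0 < p - 1 := by linarith
  have hp0 : 0 < p := by linarith
  refine ⟨(p * (N * 2) / (p - 1) * 2 ^ (p - 1)).toNNReal, ?_⟩
  intro R μ _ g G hg hg0 hGm hG
  set κ := μ.withDensity fun x => ENNReal.ofReal (g x) with hκ
  -- The layer-cake formula is for real-valued functions, hence the truncation; monotone convergence
  -- removes it at the end.
  have htrunc : ∀ n : ℕ, ∫⁻ x, (min (G x) n) ^ p ∂μ ≤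
      ENNReal.ofReal (p * (N * 2) / (p - 1) * 2 ^ (p - 1)) *
        ∫⁻ x, ENNReal.ofReal (g x) ^ p ∂μ := by
    intro n
    have hfin : ∀ x, min (G x) n ≠ ∞ := fun x =>
      ne_top_of_le_ne_top (ENNReal.natCast_ne_top n) (min_le_right _ _)
    calc ∫⁻ x, (min (G x) n) ^ p ∂μ
        = ∫⁻ x, ENNReal.ofReal ((min (G x) n).toReal ^ p) ∂μ := by
          refine lintegral_congr fun x => ?_
          rw [← ENNReal.ofReal_rpow_of_nonneg ENNReal.toReal_nonneg hp0.le,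
            ENNReal.ofReal_toReal (hfin x)]
      _ = ENNReal.ofReal p * ∫⁻ t in Ioi (0 : ℝ), μ {x | t < (min (G x) n).toReal} *
            ENNReal.ofReal (t ^ (p - 1)) :=
          lintegral_rpow_eq_lintegral_meas_lt_mul μ
            (Filter.Eventually.of_forall fun _ => ENNReal.toReal_nonneg)
            (hGm.min measurable_const).ennreal_toReal.aemeasurable hp0
      -- The factor 2/t of the weak type estimate turns t^(p-1) into t^(p-2), which is the
      -- layer-cake density for the power p - 1 of 2g against κ = g μ.
      _ ≤ ENNReal.ofReal p * ∫⁻ t in Ioi (0 : ℝ), ENNReal.ofReal (N * 2) *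
            (κ {x | t < 2 * g x} * ENNReal.ofReal (t ^ (p - 1 - 1))) := by
          refine mul_le_mul' le_rfl ?_
          refine setLIntegral_mono' measurableSet_Ioi fun t ht => ?_
          have ht : 0 < t := ht
          have h1 : μ {x | t < (min (G x) n).toReal} ≤ μ {x | ENNReal.ofReal t < G x} := by
            refine measure_mono fun x hx => ?_
            have : ENNReal.ofReal t < min (G x) n :=
              (ENNReal.ofReal_lt_iff_lt_toReal ht.le (hfin x)).2 hx
            exact this.trans_le (min_le_left _ _)
          calc _ ≤ N * (ENNReal.ofReal (2 / t) * κ {x | t < 2 * g x}) *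
                ENNReal.ofReal (t ^ (p - 1)) := by
                gcongr
                exact h1.trans (measure_lt_le_of_lt_average hN hg hG ht)
            _ = (N * ENNReal.ofReal (2 / t) * ENNReal.ofReal (t ^ (p - 1))) *
                κ {x | t < 2 * g x} := by ring
            _ = (ENNReal.ofReal (N * 2) * ENNReal.ofReal (t ^ (p - 1 - 1))) *
                κ {x | t < 2 * g x} := by
                congr 1
                rw [← ENNReal.ofReal_natCast, ← ENNReal.ofReal_mul (by positivity),
                  ← ENNReal.ofReal_mul (by positivity), ← ENNReal.ofReal_mul (by positivity),
                  Real.rpow_sub_one ht.ne' (p - 1)]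
                congr 1
                field_simp
            _ = _ := by ring
      _ = ENNReal.ofReal p * (ENNReal.ofReal (N * 2) * (ENNReal.ofReal (p - 1)⁻¹ *
            (ENNReal.ofReal (p - 1) * ∫⁻ t in Ioi (0 : ℝ),
            κ {x | t < 2 * g x} * ENNReal.ofReal (t ^ (p - 1 - 1))))) := by
          rw [lintegral_const_mul' _ _ ENNReal.ofReal_ne_top,
            ← mul_assoc (ENNReal.ofReal (p - 1)⁻¹), ← ENNReal.ofReal_mul (by positivity),
            inv_mul_cancel₀ hp1.ne', ENNReal.ofReal_one, one_mul]
      _ = ENNReal.ofReal p * (ENNReal.ofReal (N * 2) * (ENNReal.ofReal (p - 1)⁻¹ *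
            ∫⁻ x, ENNReal.ofReal ((2 * g x) ^ (p - 1)) ∂κ)) := by
          rw [lintegral_rpow_eq_lintegral_meas_lt_mul κ
            (Filter.Eventually.of_forall fun x => mul_nonneg zero_le_two (hg0 x))
            (hg.const_mul 2).aemeasurable hp1]
      _ = ENNReal.ofReal p * (ENNReal.ofReal (N * 2) * (ENNReal.ofReal (p - 1)⁻¹ *
            (ENNReal.ofReal (2 ^ (p - 1)) * ∫⁻ x, ENNReal.ofReal (g x) ^ p ∂μ))) := by
          congr 3
          rw [hκ, lintegral_withDensity_eq_lintegral_mul _ hg.ennreal_ofReal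
            (by fun_prop), ← lintegral_const_mul' _ _ ENNReal.ofReal_ne_top]
          refine lintegral_congr fun x => ?_
          have hgx := hg0 x
          simp only [Pi.mul_apply]
          rw [ENNReal.ofReal_rpow_of_nonneg hgx hp0.le, ← ENNReal.ofReal_mul hgx,
            ← ENNReal.ofReal_mul (by positivity), Real.mul_rpow zero_le_two hgx]
          congr 1
          rcases hgx.eq_or_lt with h | h
          · rw [← h, Real.zero_rpow hp0.ne']; simp
          · rw [Real.rpow_sub_one h.ne']; field_simp
      _ = _ := by
          rw [← mul_assoc, ← mul_assoc, ← mul_assoc, ← ENNReal.ofReal_mul (by positivity),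
            ← ENNReal.ofReal_mul (by positivity), ← ENNReal.ofReal_mul (by positivity),
            div_eq_mul_inv]
  have hsup : ∀ x, G x ^ p = ⨆ n : ℕ, (min (G x) n) ^ p := by
    intro x
    have h1 : G x = ⨆ n : ℕ, min (G x) n := by
      rw [← inf_iSup_eq, ENNReal.iSup_natCast, inf_top_eq]
    conv_lhs => rw [h1]
    exact (ENNReal.orderIsoRpow p hp0).map_iSup _
  simp_rw [hsup]
  rw [lintegral_iSup (fun n => (hGm.min measurable_const).pow_const p)]
  · exact iSup_le htrunc
  · intro m n hmn x
    dsimp only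
    gcongr

/-! ### Measurability and a.e. finiteness of the local maximal function. -/

theorem lowerSemicontinuous_measure_ball {E : Type*} [PseudoMetricSpace E] [MeasurableSpace E]
    (μ : Measure E) (r : ℝ) : LowerSemicontinuous fun x => μ (Metric.ball x r) := by
  intro x t (ht : t < μ (Metric.ball x r))
  change ∀ᶠ y in nhds x, t < μ (Metric.ball y r)
  rcases le_or_gt r 0 with hr | hr
  · simp [Metric.ball_eq_empty.2 hr] at ht
  obtain ⟨s, hs_mono, hs_mem, hs_lim⟩ := exists_seq_strictMono_tendsto' hr
  have hU : ⋃ n, Metric.ball x (s n) = Metric.ball x r := by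
    ext y
    simp only [mem_iUnion, Metric.mem_ball]
    refine ⟨fun ⟨n, hn⟩ => hn.trans (hs_mem n).2, fun h => ?_⟩
    exact (hs_lim.eventually (lt_mem_nhds h)).exists
  have hmono : Monotone fun n => Metric.ball x (s n) :=
    fun i j hij => Metric.ball_subset_ball (hs_mono.monotone hij)
  rw [← hU, hmono.measure_iUnion] at ht
  obtain ⟨n, hn⟩ := lt_iSup_iff.1 ht
  filter_upwards [Metric.ball_mem_nhds x (sub_pos.2 (hs_mem n).2)] with y hy
  refine hn.trans_le (measure_mono (Metric.ball_subset_ball' ?_))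
  rw [Metric.mem_ball, dist_comm] at hy
  linarith

/-- Ball volumes do not depend on the centre, so this is a supremum of constant multiples of
measures of balls. No measurability of g is needed, and the uncountable supremum over r is harmless.
-/
theorem lowerSemicontinuous_localMaximal {ι : Type*} [Fintype ι] (R : ℝ)
    (g : EuclideanSpace ℝ ι → ℂ) : LowerSemicontinuous (localMaximal R g) := by
  refine lowerSemicontinuous_biSup fun r hr => ?_
  have hr0 : 0 < r := hr.1
  have h1 : ∀ x : EuclideanSpace ℝ ι, (volume (Metric.ball x r))⁻¹ *
      ∫⁻ y in Metric.ball x r, ‖g y‖ₑ =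
      (volume (Metric.ball (0 : EuclideanSpace ℝ ι) r))⁻¹ *
        (volume.withDensity fun y => ‖g y‖ₑ) (Metric.ball x r) := by
    intro x
    rw [Measure.addHaar_ball_center, withDensity_apply _ Metric.isOpen_ball.measurableSet]
  simp_rw [h1]
  refine Continuous.comp_lowerSemicontinuous
    (ENNReal.continuous_const_mul (ENNReal.inv_ne_top.2 (Metric.measure_ball_pos _ _ hr0).ne'))
    (lowerSemicontinuous_measure_ball _ r) fun a b hab => ?_
  gcongr

theorem measurable_localMaximal {ι : Type*} [Fintype ι] (R : ℝ)
    (g : EuclideanSpace ℝ ι → ℂ) : Measurable (localMaximal R g) :=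
  (lowerSemicontinuous_localMaximal R g).measurable

theorem lt_localMaximal_iff {ι : Type*} [Fintype ι] {R : ℝ}
    {g : EuclideanSpace ℝ ι → ℂ} {x : EuclideanSpace ℝ ι} {t : ℝ≥0∞} :
    t < localMaximal R g x ↔ ∃ r ∈ Ioc 0 R,
      t * volume (Metric.ball x r) < ∫⁻ y in Metric.ball x r, ‖g y‖ₑ := by
  simp only [localMaximal, lt_iSup_iff, exists_prop]
  refine exists_congr fun r => and_congr_right fun hr => ?_
  have h0 := (Metric.measure_ball_pos volume x hr.1).ne'
  have h1 : volume (Metric.ball x r) ≠ ∞ := measure_ball_lt_top.ne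
  rw [mul_comm, ← div_eq_mul_inv, ENNReal.lt_div_iff_mul_lt (Or.inl h0) (Or.inl h1)]

theorem lintegral_ball_le_localMaximal_mul {ι : Type*} [Fintype ι] {R r : ℝ}
    (g : EuclideanSpace ℝ ι → ℂ) (x : EuclideanSpace ℝ ι) (hr : r ∈ Ioc 0 R) :
    ∫⁻ y in Metric.ball x r, ‖g y‖ₑ ≤ localMaximal R g x * volume (Metric.ball x r) := by
  by_contra! h
  exact lt_irrefl _ (lt_localMaximal_iff.2 ⟨r, hr, h⟩)

/-- On the part A of the infinity set within a bounded ball, every level t is exceeded, so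
Besicovitch domination gives t |A| ≤ N I for all t, with I a finite integral of |g|. Only the values
of g on S are seen from D. -/
theorem ae_localMaximal_lt_top {ι : Type*} [Fintype ι] {R : ℝ} (g : EuclideanSpace ℝ ι → ℂ)
    {D S : Set (EuclideanSpace ℝ ι)} (hDS : ∀ x ∈ D, Metric.ball x R ⊆ S)
    (hS : ∀ ρ : ℝ, ∫⁻ y in S ∩ Metric.ball 0 ρ, ‖g y‖ₑ < ∞) :
    ∀ᵐ x, x ∈ D → localMaximal R g x < ∞ := by
  obtain ⟨N, hN⟩ := exists_measure_le_of_forall_ball_lt (EuclideanSpace ℝ ι)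
  have key : ∀ k : ℕ, volume {x | x ∈ D ∩ Metric.ball 0 k ∧ localMaximal R g x = ∞} = 0 := by
    intro k
    set A := {x | x ∈ D ∩ Metric.ball 0 k ∧ localMaximal R g x = ∞}
    set I := ∫⁻ y in S ∩ Metric.ball 0 (k + R), ‖g y‖ₑ with hI
    have hle : ∀ t : ℝ≥0, t * volume A ≤ N * I := by
      intro t
      have := hN R (t • volume)
        ((volume.restrict (S ∩ Metric.ball 0 (k + R))).withDensity fun y => ‖g y‖ₑ) A ?_
      · simpa [withDensity_apply _ MeasurableSet.univ] using! this
      · rintro x ⟨⟨hxD, hxk⟩, hx⟩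
        obtain ⟨r, hr, h⟩ := lt_localMaximal_iff.1 (hx ▸ ENNReal.coe_lt_top (r := t) :
          (t : ℝ≥0∞) < localMaximal R g x)
        refine ⟨r, hr, ?_⟩
        have hB : MeasurableSet (Metric.ball x r) := Metric.isOpen_ball.measurableSet
        have hsub : Metric.ball x r ⊆ S ∩ Metric.ball 0 (k + R) := by
          refine subset_inter ((Metric.ball_subset_ball hr.2).trans (hDS x hxD)) ?_
          refine Metric.ball_subset_ball' ?_
          have := Metric.mem_ball.1 hxk
          linarith [hr.2]
        rw [withDensity_apply _ hB, Measure.restrict_restrict_of_subset hsub]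
        simpa using! h
    by_contra h0
    have hM : N * I ≠ ∞ := ENNReal.mul_ne_top (ENNReal.natCast_ne_top N) (hS _).ne
    have hA : volume A ≠ ∞ := by
      have := hle 1
      rw [ENNReal.coe_one, one_mul] at this
      exact ne_top_of_le_ne_top hM this
    -- With this t, the product t |A| equals N I + |A|, which forces |A| = 0.
    have := hle ((N * I).toNNReal / (volume A).toNNReal + 1)
    have h0' : (volume A).toNNReal ≠ 0 := by simp [ENNReal.toNNReal_eq_zero_iff, h0, hA]
    rw [← ENNReal.coe_toNNReal hA, ← ENNReal.coe_toNNReal hM, ← ENNReal.coe_mul,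
      ENNReal.coe_le_coe] at this
    simp only [ENNReal.toNNReal_coe] at this
    rw [add_mul, div_mul_cancel₀ _ h0', one_mul] at this
    exact h0' (le_antisymm (by simpa using this) zero_le)
  rw [ae_iff]
  refine measure_mono_null ?_ (measure_iUnion_null key)
  intro x hx
  simp only [mem_ofPred_eq, Classical.not_imp, not_lt, top_le_iff] at hx
  obtain ⟨k, hk⟩ := exists_nat_gt ‖x‖
  exact mem_iUnion.2 ⟨k, ⟨hx.1, by simpa using hk⟩, hx.2⟩

/-! ### Euclidean covers and transport of integrals. -/

/-- A measure space `X` covered by a Euclidean space `E`: a continuous projection `E → X`, a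
section of it with values in a fundamental domain `dom`, and a region of `E` containing the
half-unit balls centred in `dom`, on which the projection has bounded multiplicity. -/
structure EuclideanCover (X : Type*) [TopologicalSpace X] [MeasureSpace X]
    (ι : Type*) [Fintype ι] where
  proj : EuclideanSpace ℝ ι → X
  lift : X → EuclideanSpace ℝ ι
  dom : Set (EuclideanSpace ℝ ι)
  region : Set (EuclideanSpace ℝ ι)
  multiplicity : ℝ≥0
  continuous_proj : Continuous proj
  proj_lift : ∀ x, proj (lift x) = x
  measurableSet_dom : MeasurableSet dom
  measurePreserving_lift : MeasurePreserving lift volume (volume.restrict dom)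
  lift_mem : ∀ x, lift x ∈ dom
  ball_subset : ∀ z ∈ dom, Metric.ball z (1 / 2) ⊆ region
  measurableSet_region : MeasurableSet region
  map_proj_le : (volume.restrict region).map proj ≤ (multiplicity : ℝ≥0∞) • volume
  isBounded_lift : ∀ K, IsCompact K → Bornology.IsBounded (lift '' K)

namespace EuclideanCover

variable {X : Type*} [TopologicalSpace X] [MeasureSpace X] {ι : Type*} [Fintype ι]

/-- The local maximal operator transported to the base of a Euclidean cover. -/
noncomputable def maximal (c : EuclideanCover X ι) (f : X → ℂ) (x : X) : ℝ≥0∞ :=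
  localMaximal (1 / 2) (fun z => f (c.proj z)) (c.lift x)

theorem measurable_maximal (c : EuclideanCover X ι) (f : X → ℂ) : Measurable (c.maximal f) :=
  (measurable_localMaximal _ _).comp c.measurePreserving_lift.measurable

theorem dom_subset_region (c : EuclideanCover X ι) : c.dom ⊆ c.region := fun z hz =>
  c.ball_subset z hz (Metric.mem_ball_self (by norm_num))

theorem lintegral_lift (c : EuclideanCover X ι) {h : EuclideanSpace ℝ ι → ℝ≥0∞}
    (hh : Measurable h) : ∫⁻ x, h (c.lift x) = ∫⁻ z in c.dom, h z :=
  c.measurePreserving_lift.lintegral_comp hh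

variable [BorelSpace X]

theorem measurable_proj (c : EuclideanCover X ι) : Measurable c.proj :=
  c.continuous_proj.measurable

theorem lintegral_region_le (c : EuclideanCover X ι) {h : X → ℝ≥0∞} (hh : Measurable h) :
    ∫⁻ z in c.region, h (c.proj z) ≤ c.multiplicity * ∫⁻ x, h x := by
  rw [← lintegral_map hh c.measurable_proj]
  exact (lintegral_mono' c.map_proj_le le_rfl).trans_eq (lintegral_smul_measure _ _)

theorem ae_region (c : EuclideanCover X ι) {P : X → Prop} (hP : ∀ᵐ x, P x) :
    ∀ᵐ z ∂(volume.restrict c.region), P (c.proj z) := by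
  refine ae_of_ae_map c.measurable_proj.aemeasurable ?_
  refine (Measure.absolutelyContinuous_of_le c.map_proj_le).trans ?_ hP
  exact Measure.smul_absolutelyContinuous

/-- Balls centred at lifted points lie in the region, where null sets pull back to null sets. The
equality is pointwise, so f may be replaced by a measurable representative. -/
theorem maximal_congr (c : EuclideanCover X ι) {f g : X → ℂ} (h : f =ᵐ[volume] g) :
    c.maximal f = c.maximal g := by
  funext x
  refine iSup_congr fun r => iSup_congr fun hr => ?_
  congr 1
  have hsub : Metric.ball (c.lift x) r ⊆ c.region :=
    (Metric.ball_subset_ball hr.2).trans (c.ball_subset _ (c.lift_mem x))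
  refine lintegral_congr_ae ((ae_restrict_of_ae_restrict_of_subset hsub (c.ae_region h)).mono ?_)
  intro z hz
  simp only [hz]

/-- A closed ball projects to a compact K; inserting the indicator of K makes the multiplicity bound
applicable. -/
theorem lintegral_region_inter_closedBall_lt_top [T2Space X] (c : EuclideanCover X ι)
    {h : X → ℝ≥0∞} (hh : Measurable h) (hloc : ∀ K, IsCompact K → ∫⁻ x in K, h x < ∞) (ρ : ℝ) :
    ∫⁻ z in c.region ∩ Metric.closedBall 0 ρ, h (c.proj z) < ∞ := by
  set K := c.proj '' Metric.closedBall 0 ρ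
  have hK : IsCompact K := (isCompact_closedBall _ _).image c.continuous_proj
  calc ∫⁻ z in c.region ∩ Metric.closedBall 0 ρ, h (c.proj z)
      = ∫⁻ z in c.region ∩ Metric.closedBall 0 ρ, K.indicator h (c.proj z) := by
        refine setLIntegral_congr_fun (c.measurableSet_region.inter measurableSet_closedBall) ?_
        intro z hz
        exact (indicator_of_mem (mem_image_of_mem _ hz.2) h).symm
    _ ≤ ∫⁻ z in c.region, K.indicator h (c.proj z) := lintegral_mono_set inter_subset_left
    _ ≤ c.multiplicity * ∫⁻ x, K.indicator h x :=
        c.lintegral_region_le (hh.indicator hK.measurableSet)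
    _ < ∞ := by
        rw [lintegral_indicator hK.measurableSet]
        exact ENNReal.mul_lt_top ENNReal.coe_lt_top (hloc K hK)

end EuclideanCover

/-! ### Sufficiency: constructing the weight u. -/

namespace EuclideanCover

variable {X : Type*} [TopologicalSpace X] [MeasureSpace X] {ι : Type*} [Fintype ι]
variable [BorelSpace X]

theorem ae_maximal_lt_top [T2Space X] (c : EuclideanCover X ι) {f : X → ℂ} (hf : Measurable f)
    (hloc : ∀ K, IsCompact K → ∫⁻ x in K, ‖f x‖ₑ < ∞) : ∀ᵐ x, c.maximal f x < ∞ := by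
  have h := ae_localMaximal_lt_top (R := 1 / 2) (fun z => f (c.proj z)) c.ball_subset fun ρ =>
    (lintegral_mono_set (inter_subset_inter_right _ Metric.ball_subset_closedBall)).trans_lt
      (c.lintegral_region_inter_closedBall_lt_top hf.enorm hloc ρ)
  exact c.measurePreserving_lift.quasiMeasurePreserving.ae
    ((ae_restrict_iff' c.measurableSet_dom).2 h)

theorem exists_mapsStrong [T2Space X] (c : EuclideanCover X ι) {v : X → ℝ} (hv : Measurable v)
    (hpos : ∀ x, 0 < v x) {p : ℝ} (hp : 1 < p)
    (hloc : ∀ K, IsCompact K → ∫⁻ x in K, ENNReal.ofReal (v x ^ (-(1 / (p - 1)))) < ∞) :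
    ∃ u : X → ℝ, IsPosWeight u ∧ MapsStrong c.maximal p v u := by
  have hp1 : 0 < p - 1 := by linarith
  have hp0 : 0 < p := by linarith
  set σ : X → ℝ := fun x => v x ^ (-(1 / (p - 1))) with hσ
  have hσm : Measurable σ := hv.pow_const _
  have hσpos : ∀ x, 0 < σ x := fun x => Real.rpow_pos_of_pos (hpos x) _
  set s : X → ℂ := fun x => (σ x : ℂ) with hs
  have hsm : Measurable s := Complex.measurable_ofReal.comp hσm
  have hsn : ∀ x, ‖s x‖ₑ = ENNReal.ofReal (σ x) := fun x => by
    rw [← ofReal_norm, hs, Complex.norm_real, Real.norm_of_nonneg (hσpos x).le]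
  have hfin : ∀ᵐ x, c.maximal s x < ∞ := c.ae_maximal_lt_top hsm (by simpa only [hsn] using hloc)
  -- The summand 1 keeps the denominator away from zero; u vanishes only on the null set where the
  -- maximal function of σ is infinite.
  set u : X → ℝ := fun x => (ENNReal.ofReal (σ x) / (1 + c.maximal s x) ^ p).toReal with hu
  have hum : Measurable u :=
    (hσm.ennreal_ofReal.div (((c.measurable_maximal s).const_add 1).pow_const p)).ennreal_toReal
  obtain ⟨C, hC⟩ := exists_lintegral_rpow_le_of_lt_average (EuclideanSpace ℝ ι) hp
  set μ := (volume.restrict c.region).withDensity fun z => ENNReal.ofReal (σ (c.proj z)) with hμ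
  have hσp : Measurable fun z => ENNReal.ofReal (σ (c.proj z)) :=
    (hσm.comp c.measurable_proj).ennreal_ofReal
  have hμball : ∀ z ∈ c.dom, ∀ r ∈ Ioc (0 : ℝ) (1 / 2), μ (Metric.ball z r) =
      ∫⁻ y in Metric.ball z r, ‖s (c.proj y)‖ₑ := by
    intro z hz r hr
    rw [hμ, withDensity_apply _ Metric.isOpen_ball.measurableSet,
      Measure.restrict_restrict_of_subset
        ((Metric.ball_subset_ball hr.2).trans (c.ball_subset z hz))]
    simp only [hsn]
  have : IsLocallyFiniteMeasure μ := ⟨fun z => ⟨Metric.ball z 1, Metric.ball_mem_nhds _ one_pos, by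
    rw [hμ, withDensity_apply _ Metric.isOpen_ball.measurableSet,
      Measure.restrict_restrict Metric.isOpen_ball.measurableSet, inter_comm]
    refine (lintegral_mono_set (inter_subset_inter_right _ ?_)).trans_lt
      (c.lintegral_region_inter_closedBall_lt_top hσm.ennreal_ofReal hloc (1 + ‖z‖))
    exact Metric.ball_subset_closedBall.trans (Metric.closedBall_subset_closedBall' (by simp))⟩⟩
  refine ⟨u, ⟨hum.aemeasurable, hfin.mono fun x hx => ?_⟩,
    ((C * c.multiplicity : ℝ≥0∞) ^ (1 / p)).toNNReal, ?_⟩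
  · have h1 : (1 + c.maximal s x) ^ p ≠ ∞ :=
      ENNReal.rpow_ne_top_of_nonneg hp0.le (ENNReal.add_lt_top.2 ⟨ENNReal.one_lt_top, hx⟩).ne
    have h2 : (1 + c.maximal s x) ^ p ≠ 0 := by
      simp [ENNReal.rpow_eq_zero_iff, hp0.not_gt]
    refine ENNReal.toReal_pos (ENNReal.div_ne_zero.2 ⟨?_, h1⟩)
      (ENNReal.div_ne_top ENNReal.ofReal_ne_top h2)
    simpa using hσpos x
  intro f hf
  obtain ⟨f', hf'm, hff'⟩ : ∃ f' : X → ℂ, Measurable f' ∧ f =ᵐ[volume] f' :=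
    ⟨_, hf.1.aemeasurable.measurable_mk, hf.1.aemeasurable.ae_eq_mk⟩
  -- The maximal theorem asks for a good ball at every point where G exceeds t; the indicator
  -- confines this to `dom`, whose balls lie in the region and do not see the restriction in μ.
  set G : EuclideanSpace ℝ ι → ℝ≥0∞ := c.dom.indicator fun z =>
    localMaximal (1 / 2) (fun z => f' (c.proj z)) z /
      (1 + localMaximal (1 / 2) (fun z => s (c.proj z)) z) with hGdef
  have hGm : Measurable G := ((measurable_localMaximal _ _).div
    ((measurable_localMaximal _ _).const_add 1)).indicator c.measurableSet_dom
  set g : X → ℝ := fun x => ‖f' x‖ / σ x with hgdef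
  have hgm : Measurable g := hf'm.norm.div hσm
  have hgE : Measurable fun z => ENNReal.ofReal (g (c.proj z)) :=
    (hgm.comp c.measurable_proj).ennreal_ofReal
  have hgσ : ∀ x, ENNReal.ofReal (σ x) * ENNReal.ofReal (g x) = ‖f' x‖ₑ := by
    intro x
    rw [← ENNReal.ofReal_mul (hσpos x).le, mul_div_cancel₀ _ (hσpos x).ne', ofReal_norm]
  have hgp : ∀ x, ENNReal.ofReal (σ x) * ENNReal.ofReal (g x) ^ p =
      ‖f' x‖ₑ ^ p * ENNReal.ofReal (v x) := by
    intro x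
    have h0 : 0 ≤ g x := div_nonneg (norm_nonneg _) (hσpos x).le
    rw [← ofReal_norm, ENNReal.ofReal_rpow_of_nonneg h0 hp0.le,
      ENNReal.ofReal_rpow_of_nonneg (norm_nonneg _) hp0.le, ← ENNReal.ofReal_mul (hσpos x).le,
      ← ENNReal.ofReal_mul (by positivity), hgdef, Real.div_rpow (norm_nonneg _) (hσpos x).le]
    congr 1
    -- The exponents agree since 1 - p/(p-1) = -1/(p-1).
    have h1 : v x * σ x ^ p = σ x := by
      rw [hσ, ← Real.rpow_mul (hpos x).le]
      nth_rw 1 [← Real.rpow_one (v x)]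
      rw [← Real.rpow_add (hpos x)]
      congr 1
      field_simp
      ring
    have h2 : 0 < σ x ^ p := Real.rpow_pos_of_pos (hσpos x) _
    rw [mul_div_assoc', div_eq_iff h2.ne', mul_assoc, h1, mul_comm]
  have hG : ∀ z, ∀ t : ℝ≥0, t < G z → ∃ r ∈ Ioc (0 : ℝ) (1 / 2),
      t * μ (Metric.ball z r) < ∫⁻ y in Metric.ball z r, ENNReal.ofReal (g (c.proj y)) ∂μ := by
    intro z t ht
    have hz : z ∈ c.dom := by
      by_contra hz
      simp [hGdef, hz] at ht
    rw [hGdef, indicator_of_mem hz] at ht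
    have ht' := ENNReal.mul_lt_of_lt_div ht
    obtain ⟨r, hr, hlt⟩ := lt_localMaximal_iff.1 ht'
    refine ⟨r, hr, ?_⟩
    have hB : MeasurableSet (Metric.ball z r) := Metric.isOpen_ball.measurableSet
    rw [hμball z hz r hr, hμ, setLIntegral_withDensity_eq_setLIntegral_mul _ hσp hgE hB,
      Measure.restrict_restrict_of_subset
        ((Metric.ball_subset_ball hr.2).trans (c.ball_subset z hz))]
    simp only [Pi.mul_apply, hgσ]
    -- The chain is t σ(B) ≤ t Mσ(z) |B| ≤ t (1 + Mσ(z)) |B| < ∫_B |f'|, and the last integral is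
    -- ∫_B g dμ.
    refine lt_of_le_of_lt ?_ hlt
    rw [mul_assoc]
    gcongr
    refine (lintegral_ball_le_localMaximal_mul _ z hr).trans ?_
    gcongr
    exact le_add_self
  have main : ∫⁻ x, ‖c.maximal f x‖ₑ ^ p * ENNReal.ofReal (u x) ≤
      C * c.multiplicity * ∫⁻ x, ‖f x‖ₑ ^ p * ENNReal.ofReal (v x) := by
    calc ∫⁻ x, ‖c.maximal f x‖ₑ ^ p * ENNReal.ofReal (u x)
        ≤ ∫⁻ x, ENNReal.ofReal (σ (c.proj (c.lift x))) * G (c.lift x) ^ p := by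
          refine lintegral_mono fun x => ?_
          rw [c.proj_lift, hGdef, indicator_of_mem (c.lift_mem x),
            ENNReal.div_rpow_of_nonneg _ _ hp0.le, enorm_eq_self, c.maximal_congr hff']
          calc _ ≤ c.maximal f' x ^ p * (ENNReal.ofReal (σ x) / (1 + c.maximal s x) ^ p) := by
                gcongr
                exact ENNReal.ofReal_toReal_le
            _ = _ := by
                simp only [maximal, div_eq_mul_inv]
                ring
      _ = ∫⁻ z in c.dom, ENNReal.ofReal (σ (c.proj z)) * G z ^ p :=
          c.lintegral_lift (hσp.mul (hGm.pow_const p))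
      _ ≤ ∫⁻ z in c.region, ENNReal.ofReal (σ (c.proj z)) * G z ^ p :=
          lintegral_mono_set c.dom_subset_region
      _ = ∫⁻ z, G z ^ p ∂μ :=
          (lintegral_withDensity_eq_lintegral_mul _ hσp (hGm.pow_const p)).symm
      _ ≤ C * ∫⁻ z, ENNReal.ofReal (g (c.proj z)) ^ p ∂μ :=
          hC _ μ _ G (hgm.comp c.measurable_proj)
            (fun z => div_nonneg (norm_nonneg _) (hσpos _).le) hGm hG
      _ = C * ∫⁻ z in c.region, ‖f' (c.proj z)‖ₑ ^ p * ENNReal.ofReal (v (c.proj z)) := by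
          rw [hμ, lintegral_withDensity_eq_lintegral_mul _ hσp (hgE.pow_const p)]
          simp only [Pi.mul_apply, hgp]
      _ ≤ C * (c.multiplicity * ∫⁻ x, ‖f' x‖ₑ ^ p * ENNReal.ofReal (v x)) := by
          gcongr
          exact c.lintegral_region_le (h := fun x => ‖f' x‖ₑ ^ p * ENNReal.ofReal (v x))
            ((hf'm.enorm.pow_const p).mul hv.ennreal_ofReal)
      _ = C * c.multiplicity * ∫⁻ x, ‖f x‖ₑ ^ p * ENNReal.ofReal (v x) := by
          rw [mul_assoc]
          congr 2
          refine lintegral_congr_ae (hff'.mono fun x hx => ?_)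
          simp only [hx]
  have hnorm : weightedNorm p u (c.maximal f) ≤
      ((C * c.multiplicity : ℝ≥0∞) ^ (1 / p)).toNNReal * weightedNorm p v f := by
    rw [weightedNorm, weightedNorm, ENNReal.coe_toNNReal (ENNReal.rpow_ne_top_of_nonneg
      (by positivity) (ENNReal.mul_ne_top ENNReal.coe_ne_top ENNReal.coe_ne_top)),
      ← ENNReal.mul_rpow_of_nonneg _ _ (by positivity)]
    gcongr
  exact ⟨⟨(c.measurable_maximal f).aestronglyMeasurable,
    hnorm.trans_lt (ENNReal.mul_lt_top ENNReal.coe_lt_top hf.2)⟩, hnorm⟩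

/-- The weight is a function U of the lift satisfying U(w) ≤ v a.e. on every admissible ball
containing w. So |f|-averages above t yield ∫_B U < t⁻¹ ∫_B |f| v, which is the input of Besicovitch
domination. -/
theorem exists_mapsWeakBounded (c : EuclideanCover X ι) {v : X → ℝ}
    (hv : Measurable v) (hpos : ∀ x, 0 < v x)
    (hloc : ∀ K, IsCompact K → ∃ a : ℝ, ∀ᵐ x, x ∈ K → (v x)⁻¹ ≤ a) :
    ∃ u : X → ℝ, IsPosWeight u ∧ MapsWeakBounded c.maximal v u := by
  -- Points of a ball of radius at most 1/2 are within distance 1 of each other, hence radius k + 1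
  -- for centres of norm at most k.
  choose a ha using fun k : ℕ => hloc (c.proj '' Metric.closedBall 0 (k + 1))
    ((isCompact_closedBall _ _).image c.continuous_proj)
  -- The bounds a k carry no sign; 1 + |a k| makes U positive and at most 1.
  set U : EuclideanSpace ℝ ι → ℝ := fun z => (1 + |a ⌈‖z‖⌉₊|)⁻¹ with hU
  have hUm : Measurable U := by
    have : Measurable fun k : ℕ => (1 + |a k|)⁻¹ := measurable_from_top
    exact this.comp (Nat.measurable_ceil.comp measurable_norm)
  have hUpos : ∀ z, 0 < U z := fun z => by positivity
  have hU1 : ∀ z, U z ≤ 1 := fun z => inv_le_one_of_one_le₀ (by simp)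
  have hUv : ∀ᵐ y ∂(volume.restrict c.region), ∀ z, ‖y‖ ≤ ‖z‖ + 1 → U z ≤ v (c.proj y) := by
    filter_upwards [c.ae_region (ae_all_iff.2 ha)] with y hy z hyz
    have h := hy ⌈‖z‖⌉₊ (mem_image_of_mem _ (by
      rw [mem_closedBall_zero_iff]
      linarith [Nat.le_ceil ‖z‖]))
    rw [hU, inv_le_comm₀ (by positivity) (hpos _)]
    linarith [le_abs_self (a ⌈‖z‖⌉₊)]
  obtain ⟨N, hN⟩ := exists_measure_le_of_forall_ball_lt (EuclideanSpace ℝ ι)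
  refine ⟨fun x => U (c.lift x), ⟨(hUm.comp c.measurePreserving_lift.measurable).aemeasurable,
    Filter.Eventually.of_forall fun x => hUpos _⟩, N * c.multiplicity, fun f hf => ?_⟩
  refine ⟨(c.measurable_maximal f).aestronglyMeasurable, fun t ht => ?_⟩
  obtain ⟨f', hf'm, hff'⟩ : ∃ f' : X → ℂ, Measurable f' ∧ f =ᵐ[volume] f' :=
    ⟨_, hf.1.aemeasurable.measurable_mk, hf.1.aemeasurable.ae_eq_mk⟩
  set M := localMaximal (1 / 2) (fun z => f' (c.proj z)) with hM
  have hA : MeasurableSet {z | (t : ℝ≥0∞) < M z} :=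
    measurableSet_lt measurable_const (measurable_localMaximal _ _)
  have hfp : Measurable fun z => ‖f' (c.proj z)‖ₑ := (hf'm.comp c.measurable_proj).enorm
  set ν := (t : ℝ≥0∞)⁻¹ • (volume.restrict c.region).withDensity
    fun z => ‖f' (c.proj z)‖ₑ * ENNReal.ofReal (v (c.proj z)) with hν
  have ht0 : (t : ℝ≥0∞) ≠ 0 := by exact_mod_cast ht.ne'
  have hball : ∀ z ∈ {z | (t : ℝ≥0∞) < M z} ∩ c.dom, ∃ r ∈ Ioc (0 : ℝ) (1 / 2),
      (volume.withDensity fun z => ENNReal.ofReal (U z)) (Metric.ball z r) <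
        ν (Metric.ball z r) := by
    rintro z ⟨hzt, hz⟩
    obtain ⟨r, hr, hlt⟩ := lt_localMaximal_iff.1 hzt
    refine ⟨r, hr, ?_⟩
    have hB : MeasurableSet (Metric.ball z r) := Metric.isOpen_ball.measurableSet
    have hsub : Metric.ball z r ⊆ c.region :=
      (Metric.ball_subset_ball hr.2).trans (c.ball_subset z hz)
    -- The constant b lies between U and v on the ball. It must be nonzero and finite for
    -- multiplication to preserve the strict inequality.
    set b := ⨆ w ∈ Metric.ball z r, ENNReal.ofReal (U w) with hb
    have hb0 : b ≠ 0 := by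
      have h1 : ENNReal.ofReal (U z) ≤ b :=
        le_iSup₂ (f := fun w (_ : w ∈ Metric.ball z r) => ENNReal.ofReal (U w)) z
          (Metric.mem_ball_self hr.1)
      exact (lt_of_lt_of_le (ENNReal.ofReal_pos.2 (hUpos z)) h1).ne'
    have hbtop : b ≠ ∞ := by
      refine ne_top_of_le_ne_top ENNReal.one_ne_top (iSup₂_le fun w _ => ?_)
      simpa using hU1 w
    rw [withDensity_apply _ hB, hν, Measure.smul_apply, withDensity_apply _ hB,
      Measure.restrict_restrict_of_subset hsub, smul_eq_mul]
    calc ∫⁻ y in Metric.ball z r, ENNReal.ofReal (U y)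
        ≤ ∫⁻ _ in Metric.ball z r, b :=
          setLIntegral_mono measurable_const fun y hy =>
            le_iSup₂ (f := fun w (_ : w ∈ Metric.ball z r) => ENNReal.ofReal (U w)) y hy
      _ = (t : ℝ≥0∞)⁻¹ * (b * (t * volume (Metric.ball z r))) := by
          rw [setLIntegral_const, mul_left_comm b, ← mul_assoc (t : ℝ≥0∞)⁻¹,
            ENNReal.inv_mul_cancel ht0 ENNReal.coe_ne_top, one_mul]
      _ < (t : ℝ≥0∞)⁻¹ * (b * ∫⁻ y in Metric.ball z r, ‖f' (c.proj y)‖ₑ) := by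
          refine ENNReal.mul_lt_mul_right (by simp) (by simpa using ht0) ?_
          exact ENNReal.mul_lt_mul_right hb0 hbtop hlt
      _ ≤ _ := by
          gcongr
          rw [← lintegral_const_mul _ hfp]
          refine lintegral_mono_ae ?_
          filter_upwards [ae_restrict_of_ae_restrict_of_subset hsub hUv,
            ae_restrict_mem hB] with y hy hyB
          rw [mul_comm]
          gcongr
          refine iSup₂_le fun w hw => ENNReal.ofReal_le_ofReal (hy w ?_)
          have h1 : dist y w < 1 := by
            have h2 := dist_triangle_right y w z
            have h3 := Metric.mem_ball.1 hyB
            have h4 := Metric.mem_ball.1 hw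
            linarith [hr.2]
          rw [dist_eq_norm] at h1
          linarith [norm_le_norm_add_norm_sub' y w]
  calc weightedDistrib (fun x => U (c.lift x)) (c.maximal f) t
      = ∫⁻ x in c.lift ⁻¹' {z | (t : ℝ≥0∞) < M z}, ENNReal.ofReal (U (c.lift x)) := by
        rw [c.maximal_congr hff']
        rfl
    _ = (volume.withDensity fun z => ENNReal.ofReal (U z))
          ({z | (t : ℝ≥0∞) < M z} ∩ c.dom) := by
        rw [c.measurePreserving_lift.setLIntegral_comp_preimage hA hUm.ennreal_ofReal,
          Measure.restrict_restrict hA, withDensity_apply _ (hA.inter c.measurableSet_dom)]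
    _ ≤ N * ν univ := hN _ _ _ _ hball
    _ = N * ((t : ℝ≥0∞)⁻¹ * ∫⁻ z in c.region,
          ‖f' (c.proj z)‖ₑ * ENNReal.ofReal (v (c.proj z))) := by
        rw [hν, Measure.smul_apply, withDensity_apply _ MeasurableSet.univ, smul_eq_mul,
          Measure.restrict_univ]
    _ ≤ N * ((t : ℝ≥0∞)⁻¹ * (c.multiplicity * ∫⁻ x, ‖f' x‖ₑ * ENNReal.ofReal (v x))) := by
        gcongr
        exact c.lintegral_region_le (h := fun x => ‖f' x‖ₑ * ENNReal.ofReal (v x))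
          (hf'm.enorm.mul hv.ennreal_ofReal)
    _ = (N * c.multiplicity : ℝ≥0) * weightedNorm 1 v f / t := by
        have : weightedNorm 1 v f = ∫⁻ x, ‖f' x‖ₑ * ENNReal.ofReal (v x) := by
          simp only [weightedNorm, ENNReal.rpow_one, div_one]
          refine lintegral_congr_ae (hff'.mono fun x hx => ?_)
          simp only [hx]
        rw [this, div_eq_mul_inv]
        push_cast
        ring

end EuclideanCover

/-! ### Necessity: testing the operator on small pieces. -/

theorem setLIntegral_weight_ne_zero {X : Type*} [MeasureSpace X] {u : X → ℝ} (hu : IsPosWeight u)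
    {U : Set X}
    (hU : volume U ≠ 0) : ∫⁻ x in U, ENNReal.ofReal (u x) ≠ 0 := by
  intro h0
  rw [lintegral_eq_zero_iff' hu.1.ennreal_ofReal.restrict] at h0
  refine hU (Measure.restrict_eq_zero.1 (ae_eq_bot.1 (Filter.eventually_false_iff_eq_bot.1 ?_)))
  filter_upwards [h0, ae_restrict_of_ae hu.2] with x hx hx'
  exact (ENNReal.ofReal_pos.2 hx').ne' hx

namespace EuclideanCover

variable {X : Type*} [TopologicalSpace X] [MeasureSpace X] {ι : Type*} [Fintype ι]

theorem exists_finite_cover (c : EuclideanCover X ι) {K : Set X} (hK : IsCompact K) :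
    ∃ t : Set (EuclideanSpace ℝ ι), t.Finite ∧
      K ⊆ ⋃ z ∈ t, c.lift ⁻¹' Metric.ball z (1 / 8) := by
  obtain ⟨t, ht, hsub⟩ := Metric.totallyBounded_iff.1
    ((c.isBounded_lift K hK).isCompact_closure.totallyBounded.subset subset_closure)
    (1 / 8) (by norm_num)
  refine ⟨t, ht, fun x hx => ?_⟩
  have := hsub (mem_image_of_mem c.lift hx)
  simpa only [mem_iUnion, mem_preimage] using! this

theorem measurableSet_lift_preimage_ball (c : EuclideanCover X ι) (z : EuclideanSpace ℝ ι) :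
    MeasurableSet (c.lift ⁻¹' Metric.ball z (1 / 8)) :=
  c.measurePreserving_lift.measurable Metric.isOpen_ball.measurableSet

theorem volume_lift_preimage_ball_lt_top (c : EuclideanCover X ι) (z : EuclideanSpace ℝ ι) :
    volume (c.lift ⁻¹' Metric.ball z (1 / 8)) < ∞ := by
  rw [c.measurePreserving_lift.measure_preimage Metric.isOpen_ball.measurableSet.nullMeasurableSet]
  exact (Measure.restrict_apply_le _ _).trans_lt measure_ball_lt_top

/-- Since 1/8 + 1/8 < 1/2, the ball of radius 1/2 about any lifted point of the piece contains the
whole lifted piece. This is the only lower bound for the operator that necessity requires. -/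
theorem le_maximal [BorelSpace X] (c : EuclideanCover X ι) {f : X → ℂ} (hf : Measurable f)
    (z : EuclideanSpace ℝ ι) {x : X} (hx : c.lift x ∈ Metric.ball z (1 / 8)) :
    (volume (Metric.ball (0 : EuclideanSpace ℝ ι) (1 / 2)))⁻¹ *
      ∫⁻ y in c.lift ⁻¹' Metric.ball z (1 / 8), ‖f y‖ₑ ≤ c.maximal f x := by
  have hfm : Measurable fun w => ‖f (c.proj w)‖ₑ := (hf.comp c.measurable_proj).enorm
  have h1 : ∫⁻ y in c.lift ⁻¹' Metric.ball z (1 / 8), ‖f y‖ₑ ≤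
      ∫⁻ w in Metric.ball (c.lift x) (1 / 2), ‖f (c.proj w)‖ₑ := by
    have h2 := c.measurePreserving_lift.setLIntegral_comp_preimage
      (s := Metric.ball z (1 / 8)) Metric.isOpen_ball.measurableSet hfm
    simp only [c.proj_lift] at h2
    rw [h2, Measure.restrict_restrict Metric.isOpen_ball.measurableSet]
    refine lintegral_mono_set (inter_subset_left.trans (Metric.ball_subset_ball' ?_))
    rw [Metric.mem_ball, dist_comm] at hx
    linarith
  refine le_trans ?_ (le_iSup₂ (1 / 2 : ℝ) ⟨by norm_num, le_rfl⟩)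
  rw [Measure.addHaar_ball_center volume (c.lift x)]
  gcongr

variable [BorelSpace X]

theorem ae_inv_le_of_mapsIntoWeak (c : EuclideanCover X ι) {v u : X → ℝ} (hv : Measurable v)
    (hpos : ∀ x, 0 < v x) (hu : IsPosWeight u) (h : MapsIntoWeak c.maximal v u)
    {K : Set X} (hK : IsCompact K) : ∃ a : ℝ, ∀ᵐ x, x ∈ K → (v x)⁻¹ ≤ a := by
  have local_bound : ∀ z : EuclideanSpace ℝ ι, ∃ a : ℝ,
      ∀ᵐ x, x ∈ c.lift ⁻¹' Metric.ball z (1 / 8) → (v x)⁻¹ ≤ a := by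
    intro z
    set U := c.lift ⁻¹' Metric.ball z (1 / 8) with hUdef
    have hUm : MeasurableSet U := c.measurableSet_lift_preimage_ball z
    by_contra! hcon
    -- Mass 2^k is spread over E k, where v ≤ 4^(-k): the masses have infinite sum, while the
    -- weighted masses are at most 2^(-k).
    set E : ℕ → Set X := fun k => U ∩ {x | (4 : ℝ) ^ k < (v x)⁻¹} with hE
    have hEm : ∀ k, MeasurableSet (E k) := fun k =>
      hUm.inter (measurableSet_lt measurable_const hv.inv)
    have hE0 : ∀ k, volume (E k) ≠ 0 := by
      intro k h0
      refine hcon (4 ^ k) ?_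
      rw [ae_iff]
      refine measure_mono_null (fun x hx => ?_) h0
      simpa [hE] using hx
    have hEtop : ∀ k, volume (E k) ≠ ∞ := fun k =>
      ne_top_of_le_ne_top (c.volume_lift_preimage_ball_lt_top z).ne (measure_mono inter_subset_left)
    set φ : X → ℝ≥0∞ := fun x => ∑' k, (E k).indicator (fun _ => 2 ^ k / volume (E k)) x with hφ
    have hφm : Measurable φ := .tsum fun k => measurable_const.indicator (hEm k)
    have hφU : ∫⁻ x in U, φ x = ∞ := by
      rw [hφ, lintegral_tsum fun k => (measurable_const.indicator (hEm k)).aemeasurable]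
      have h1 : ∀ k, ∫⁻ x in U, (E k).indicator (fun _ => 2 ^ k / volume (E k)) x = 2 ^ k := by
        intro k
        rw [lintegral_indicator (hEm k), Measure.restrict_restrict_of_subset inter_subset_left,
          setLIntegral_const, ENNReal.div_mul_cancel (hE0 k) (hEtop k)]
      simp_rw [h1]
      rw [← top_le_iff, ← ENNReal.tsum_const_eq_top_of_ne_zero (α := ℕ) one_ne_zero]
      exact ENNReal.tsum_le_tsum fun k => one_le_pow₀ one_le_two
    have hφv : ∫⁻ x, φ x * ENNReal.ofReal (v x) < ∞ := by
      simp_rw [hφ, ← ENNReal.tsum_mul_right]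
      have hm : ∀ k, AEMeasurable (fun x => (E k).indicator
          (fun _ => (2 : ℝ≥0∞) ^ k / volume (E k)) x * ENNReal.ofReal (v x)) := fun k =>
        ((measurable_const.indicator (hEm k)).mul hv.ennreal_ofReal).aemeasurable
      rw [lintegral_tsum hm]
      have h1 : ∀ k, ∫⁻ x, (E k).indicator (fun _ => 2 ^ k / volume (E k)) x *
          ENNReal.ofReal (v x) ≤ 2⁻¹ ^ k := by
        intro k
        calc _ ≤ ∫⁻ x, (E k).indicator
              (fun _ => 2 ^ k / volume (E k) * (4 ^ k)⁻¹) x := by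
              refine lintegral_mono fun x => ?_
              by_cases hx : x ∈ E k
              · simp only [indicator_of_mem hx]
                gcongr
                have h2 : v x ≤ ((4 : ℝ) ^ k)⁻¹ :=
                  (le_inv_comm₀ (hpos x) (by positivity)).2 (le_of_lt hx.2)
                refine (ENNReal.ofReal_le_ofReal h2).trans_eq ?_
                rw [ENNReal.ofReal_inv_of_pos (by positivity), ENNReal.ofReal_pow (by norm_num)]
                norm_num
              · simp [hx]
          _ = 2 ^ k * (4 ^ k)⁻¹ := by
              rw [lintegral_indicator (hEm k), setLIntegral_const, mul_right_comm,
                ENNReal.div_mul_cancel (hE0 k) (hEtop k)]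
          _ = 2⁻¹ ^ k := by
              rw [show (4 : ℝ≥0∞) = 2 * 2 by norm_num, mul_pow, ENNReal.mul_inv (by simp) (by simp),
                ← mul_assoc, ENNReal.mul_inv_cancel (by simp) (by simp), one_mul, ENNReal.inv_pow]
      refine (ENNReal.tsum_le_tsum h1).trans_lt ?_
      rw [ENNReal.tsum_geometric]
      simp
    -- A complex-valued f needs φ finite a.e.; this follows from integrability of φ v and positivity
    -- of v.
    have hφfin : ∀ᵐ x, φ x ≠ ∞ := by
      filter_upwards [ae_lt_top (hφm.mul hv.ennreal_ofReal) hφv.ne] with x hx htop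
      simp [htop, hpos x, ENNReal.top_mul] at hx
    set f : X → ℂ := fun x => ((φ x).toReal : ℂ) with hf
    have hfm : Measurable f := Complex.measurable_ofReal.comp hφm.ennreal_toReal
    have hfφ : ∀ᵐ x, ‖f x‖ₑ = φ x := hφfin.mono fun x hx => by
      rw [← ofReal_norm, hf, Complex.norm_real, Real.norm_of_nonneg ENNReal.toReal_nonneg,
        ENNReal.ofReal_toReal hx]
    obtain ⟨-, C, hC⟩ := h f ⟨hfm.aestronglyMeasurable, by
      simp only [weightedNorm, ENNReal.rpow_one, div_one]
      rwa [lintegral_congr_ae (hfφ.mono fun x hx => by rw [hx])]⟩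
    have hTf : ∀ x ∈ U, c.maximal f x = ∞ := by
      intro x hx
      have h1 := c.le_maximal hfm z hx
      rw [← hUdef, lintegral_congr_ae (ae_restrict_of_ae hfφ), hφU,
        ENNReal.mul_top (ENNReal.inv_ne_zero.2 measure_ball_lt_top.ne)] at h1
      exact top_le_iff.1 h1
    -- U lies in every superlevel set, so its u-measure is at most C/t for all t, hence zero.
    have hbound : ∀ t : ℝ≥0, 0 < t → ∫⁻ x in U, ENNReal.ofReal (u x) ≤ C / t := fun t ht =>
      (lintegral_mono_set fun x hx => by simp [hTf x hx]).trans (hC t ht)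
    have hU0 : volume U ≠ 0 := fun h0 => hE0 0 (measure_mono_null inter_subset_left h0)
    refine setLIntegral_weight_ne_zero hu hU0 (nonpos_iff_eq_zero.1 ?_)
    have hlim : Filter.Tendsto (fun n : ℕ => (C : ℝ≥0∞) / n) Filter.atTop (nhds 0) := by
      simpa using! ENNReal.Tendsto.const_div ENNReal.tendsto_nat_nhds_top (Or.inr ENNReal.coe_ne_top)
    refine ge_of_tendsto hlim ((Filter.eventually_gt_atTop 0).mono fun n hn => ?_)
    simpa using hbound n (by exact_mod_cast hn)
  choose a ha using local_bound
  obtain ⟨t, ht, hKt⟩ := c.exists_finite_cover hK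
  obtain ⟨b, hb⟩ := (ht.image a).bddAbove
  refine ⟨b, ?_⟩
  filter_upwards [(ae_ball_iff ht.countable).2 fun z _ => ha z] with x hx hxK
  obtain ⟨z, hz, hxz⟩ := mem_iUnion₂.1 (hKt hxK)
  exact (hx z hz hxz).trans (hb (mem_image_of_mem a hz))

theorem setLIntegral_rpow_lt_top_of_mapsStrong (c : EuclideanCover X ι) {v u : X → ℝ}
    (hv : Measurable v) (hpos : ∀ x, 0 < v x) (hu : IsPosWeight u) {p : ℝ} (hp : 1 < p)
    (h : MapsStrong c.maximal p v u) {K : Set X} (hK : IsCompact K) :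
    ∫⁻ x in K, ENNReal.ofReal (v x ^ (-(1 / (p - 1)))) < ∞ := by
  have hp1 : 0 < p - 1 := by linarith
  have hp0 : 0 < p := by linarith
  obtain ⟨C, hC⟩ := h
  set σ : X → ℝ := fun x => v x ^ (-(1 / (p - 1))) with hσ
  have hσm : Measurable σ := hv.pow_const _
  have hσpos : ∀ x, 0 < σ x := fun x => Real.rpow_pos_of_pos (hpos x) _
  set κ := (volume (Metric.ball (0 : EuclideanSpace ℝ ι) (1 / 2)))⁻¹ with hκ
  have hκ0 : κ ≠ 0 := ENNReal.inv_ne_zero.2 measure_ball_lt_top.ne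
  have local_bound : ∀ z : EuclideanSpace ℝ ι,
      ∫⁻ x in c.lift ⁻¹' Metric.ball z (1 / 8), ENNReal.ofReal (σ x) < ∞ := by
    intro z
    set U := c.lift ⁻¹' Metric.ball z (1 / 8) with hUdef
    have hUm : MeasurableSet U := c.measurableSet_lift_preimage_ball z
    by_cases hU0 : volume U = 0
    · simp [Measure.restrict_eq_zero.2 hU0]
    have huU := setLIntegral_weight_ne_zero hu hU0
    set w := ∫⁻ x in U, ENNReal.ofReal (u x)
    have hκw : κ ^ p * w ≠ 0 :=
      mul_ne_zero (by simp [ENNReal.rpow_eq_zero_iff, hκ0, hp0.not_gt]) huU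
    -- Truncating at σ ≤ n makes A finite, so that a power of A can be cancelled below; the
    -- resulting bound is independent of n.
    set V : ℕ → Set X := fun n => U ∩ {x | σ x ≤ n} with hV
    have hVm : ∀ n, MeasurableSet (V n) := fun n =>
      hUm.inter (measurableSet_le hσm measurable_const)
    -- The right side solves κ^p A^p w ≤ C^p A for A. The case w = ∞ is allowed.
    have hbound : ∀ n, ∫⁻ x in V n, ENNReal.ofReal (σ x) ≤
        ((C : ℝ≥0∞) ^ p / (κ ^ p * w)) ^ (1 / (p - 1)) := by
      intro n
      set A := ∫⁻ x in V n, ENNReal.ofReal (σ x) with hA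
      rcases eq_or_ne A 0 with hA0 | hA0
      · rw [hA0]; exact zero_le
      have hAtop : A ≠ ∞ := by
        refine ne_top_of_le_ne_top (ENNReal.mul_ne_top (ENNReal.natCast_ne_top n)
          (c.volume_lift_preimage_ball_lt_top z).ne) ?_
        calc A ≤ ∫⁻ _ in V n, (n : ℝ≥0∞) :=
              setLIntegral_mono measurable_const fun x hx => by
                simpa using ENNReal.ofReal_le_ofReal hx.2
          _ = n * volume (V n) := setLIntegral_const _ _
          _ ≤ n * volume U := by gcongr; exact inter_subset_left
      set f : X → ℂ := (V n).indicator fun x => (σ x : ℂ) with hf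
      have hfm : Measurable f := (Complex.measurable_ofReal.comp hσm).indicator (hVm n)
      have hfn : ∀ x, ‖f x‖ₑ = (V n).indicator (fun x => ENNReal.ofReal (σ x)) x := by
        intro x
        by_cases hx : x ∈ V n
        · rw [hf, indicator_of_mem hx, indicator_of_mem hx, ← ofReal_norm, Complex.norm_real,
            Real.norm_of_nonneg (hσpos x).le]
        · simp [hf, hx]
      have hfU : ∫⁻ x in U, ‖f x‖ₑ = A := by
        simp_rw [hfn]
        rw [lintegral_indicator (hVm n), Measure.restrict_restrict_of_subset inter_subset_left]
      have hfv : ∫⁻ x, ‖f x‖ₑ ^ p * ENNReal.ofReal (v x) = A := by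
        rw [hA, ← lintegral_indicator (hVm n)]
        refine lintegral_congr fun x => ?_
        rw [hfn]
        by_cases hx : x ∈ V n
        · simp only [indicator_of_mem hx]
          rw [ENNReal.ofReal_rpow_of_nonneg (hσpos x).le hp0.le,
            ← ENNReal.ofReal_mul (Real.rpow_nonneg (hσpos x).le _), hσ, ← Real.rpow_mul (hpos x).le]
          nth_rw 2 [← Real.rpow_one (v x)]
          rw [← Real.rpow_add (hpos x)]
          congr 2
          field_simp
          ring
        · simp [hx, hp0]
      have hnorm : weightedNorm p v f = A ^ (1 / p) := by rw [weightedNorm, hfv]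
      have hstrong := (hC f ⟨hfm.aestronglyMeasurable, by
        rw [hnorm]; exact (ENNReal.rpow_ne_top_of_nonneg (by positivity) hAtop).lt_top⟩).2
      have hlow : (κ * A) ^ p * w ≤ ∫⁻ x, ‖c.maximal f x‖ₑ ^ p * ENNReal.ofReal (u x) := by
        calc (κ * A) ^ p * w ≤ ∫⁻ x in U, (κ * A) ^ p * ENNReal.ofReal (u x) :=
              lintegral_const_mul_le _ _
          _ ≤ ∫⁻ x in U, ‖c.maximal f x‖ₑ ^ p * ENNReal.ofReal (u x) := by
              refine setLIntegral_mono' hUm fun x hx => ?_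
              have := c.le_maximal hfm z hx
              rw [← hUdef, hfU] at this
              rw [enorm_eq_self]
              gcongr
          _ ≤ _ := setLIntegral_le_lintegral _ _
      have hpow : (κ * A) ^ p * w ≤ (C : ℝ≥0∞) ^ p * A := by
        rw [weightedNorm, hnorm, one_div] at hstrong
        calc _ ≤ _ := hlow
          _ = ((∫⁻ x, ‖c.maximal f x‖ₑ ^ p * ENNReal.ofReal (u x)) ^ p⁻¹) ^ p :=
              (ENNReal.rpow_inv_rpow hp0.ne' _).symm
          _ ≤ (C * A ^ p⁻¹) ^ p := by gcongr
          _ = _ := by rw [ENNReal.mul_rpow_of_nonneg _ _ hp0.le, ENNReal.rpow_inv_rpow hp0.ne']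
      have hpow' : A ^ (p - 1) * (κ ^ p * w) ≤ (C : ℝ≥0∞) ^ p := by
        rw [← ENNReal.mul_le_mul_iff_left hA0 hAtop]
        refine le_trans (le_of_eq ?_) hpow
        have : A ^ p = A ^ (p - 1) * A := by
          conv_rhs => rw [← ENNReal.rpow_one A, ← ENNReal.rpow_mul, one_mul]
          rw [← ENNReal.rpow_add _ _ hA0 hAtop, sub_add_cancel]
        rw [ENNReal.mul_rpow_of_nonneg _ _ hp0.le, this]
        ring
      rw [one_div, ENNReal.le_rpow_inv_iff hp1]
      exact ENNReal.le_div_iff_mul_le (Or.inl hκw) (Or.inr (by simp [hp0.le])) |>.2 hpow'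
    have hUV : U = ⋃ n, V n := by
      rw [hV, ← inter_iUnion, eq_comm, inter_eq_left]
      intro x _
      exact mem_iUnion.2 (exists_nat_ge (σ x))
    have hmono : Monotone V := fun m n hmn x hx =>
      ⟨hx.1, (show σ x ≤ m from hx.2).trans (by exact_mod_cast hmn)⟩
    rw [hUV, setLIntegral_iUnion_of_directed _ hmono.directed_le]
    refine (iSup_le hbound).trans_lt (ENNReal.rpow_ne_top_of_nonneg (by positivity) ?_).lt_top
    exact ENNReal.div_ne_top (by simp [hp0.le]) hκw
  obtain ⟨t, ht, hKt⟩ := c.exists_finite_cover hK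
  refine (lintegral_mono_set hKt).trans_lt ?_
  have := ht.fintype
  rw [biUnion_eq_iUnion]
  refine (lintegral_iUnion_le _ _).trans_lt ?_
  rw [tsum_fintype]
  exact ENNReal.sum_lt_top.2 fun z _ => local_bound z

end EuclideanCover

/-! ### Null-set changes of the weight and the two local conditions. -/

theorem IsPosWeight.exists_measurable_pos {X : Type*} [MeasureSpace X] {v : X → ℝ}
    (hv : IsPosWeight v) : ∃ w : X → ℝ, Measurable w ∧ (∀ x, 0 < w x) ∧ v =ᵐ[volume] w := by
  have hm := hv.1.measurable_mk
  refine ⟨fun x => if 0 < hv.1.mk v x then hv.1.mk v x else 1,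
    Measurable.ite (measurableSet_lt measurable_const hm) hm measurable_const, fun x => ?_, ?_⟩
  · dsimp only
    split_ifs with h
    exacts [h, one_pos]
  · filter_upwards [hv.1.ae_eq_mk, hv.2] with x hx hpos
    rw [← hx, if_pos hpos]

theorem weightedNorm_congr_weight {X ε : Type*} [MeasureSpace X] [ENorm ε] {v w : X → ℝ}
    (h : v =ᵐ[volume] w) (p : ℝ) (g : X → ε) : weightedNorm p v g = weightedNorm p w g := by
  unfold weightedNorm
  rw [lintegral_congr_ae (h.mono fun x hx => by rw [hx])]

theorem memWeightedLp_congr_weight {X ε : Type*} [MeasureSpace X] [TopologicalSpace ε] [ENorm ε]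
    {v w : X → ℝ} (h : v =ᵐ[volume] w) (p : ℝ) (g : X → ε) :
    MemWeightedLp p v g ↔ MemWeightedLp p w g := by
  rw [MemWeightedLp, MemWeightedLp, weightedNorm_congr_weight h]

theorem mapsStrong_congr_weight {X : Type*} [MeasureSpace X] {v w : X → ℝ}
    (h : v =ᵐ[volume] w) (T : (X → ℂ) → X → ℝ≥0∞) (p : ℝ) (u : X → ℝ) :
    MapsStrong T p v u ↔ MapsStrong T p w u := by
  simp only [MapsStrong, memWeightedLp_congr_weight h, weightedNorm_congr_weight h]

theorem mapsIntoWeak_congr_weight {X : Type*} [MeasureSpace X] {v w : X → ℝ}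
    (h : v =ᵐ[volume] w) (T : (X → ℂ) → X → ℝ≥0∞) (u : X → ℝ) :
    MapsIntoWeak T v u ↔ MapsIntoWeak T w u := by
  simp only [MapsIntoWeak, memWeightedLp_congr_weight h]

theorem mapsWeakBounded_congr_weight {X : Type*} [MeasureSpace X] {v w : X → ℝ}
    (h : v =ᵐ[volume] w) (T : (X → ℂ) → X → ℝ≥0∞) (u : X → ℝ) :
    MapsWeakBounded T v u ↔ MapsWeakBounded T w u := by
  simp only [MapsWeakBounded, memWeightedLp_congr_weight h, weightedNorm_congr_weight h]

theorem MapsWeakBounded.mapsIntoWeak {X : Type*} [MeasureSpace X] {T : (X → ℂ) → X → ℝ≥0∞}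
    {v u : X → ℝ} (h : MapsWeakBounded T v u) : MapsIntoWeak T v u := by
  obtain ⟨C, hC⟩ := h
  refine fun f hf => ⟨(hC f hf).1, C * (weightedNorm 1 v f).toNNReal, fun t ht => ?_⟩
  rw [ENNReal.coe_mul, ENNReal.coe_toNNReal hf.2.ne]
  exact (hC f hf).2 t ht

/-- Here p' = p/(p-1), so the p'-th power of v^(-1/p) is v^(-1/(p-1)). -/
theorem memLocLp_rpow_iff_lintegral {X : Type*} [TopologicalSpace X] [MeasureSpace X]
    {v w : X → ℝ} (hw : Measurable w) (hpos : ∀ x, 0 < w x) (h : v =ᵐ[volume] w) {p p' : ℝ}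
    (hp : 1 < p) (hpp' : 1 / p + 1 / p' = 1) :
    MemLocLp (fun x => v x ^ (-(1 / p))) (ENNReal.ofReal p') ↔
      ∀ K : Set X, IsCompact K → ∫⁻ x in K, ENNReal.ofReal (w x ^ (-(1 / (p - 1)))) < ∞ := by
  have hp1 : p - 1 ≠ 0 := by linarith
  have hp0 : p ≠ 0 := by linarith
  have hp'eq : p' = p / (p - 1) := by
    have h1 : 1 / p' = (p - 1) / p := by
      field_simp at hpp' ⊢
      linarith
    rw [← one_div_one_div p', h1, one_div_div]
  have hp' : 0 < p' := hp'eq ▸ div_pos (by linarith) (by linarith)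
  refine forall₂_congr fun K _ => ?_
  have hae : (fun x => v x ^ (-(1 / p))) =ᵐ[volume.restrict K] fun x => w x ^ (-(1 / p)) :=
    ae_restrict_of_ae (h.mono fun x hx => by simp only [hx])
  rw [memLp_congr_ae hae, MemLp, and_iff_right (hw.pow_const _).aestronglyMeasurable,
    eLpNorm_lt_top_iff_lintegral_rpow_enorm_lt_top (by simpa using hp') ENNReal.ofReal_ne_top,
    ENNReal.toReal_ofReal hp'.le]
  refine iff_of_eq (congrArg (· < ∞) (lintegral_congr fun x => ?_))
  have hx := Real.rpow_pos_of_pos (hpos x) (-(1 / p))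
  rw [← ofReal_norm, Real.norm_of_nonneg hx.le, ENNReal.ofReal_rpow_of_nonneg hx.le hp'.le,
    ← Real.rpow_mul (hpos x).le, hp'eq]
  congr 2
  field_simp

theorem memLocLp_inv_iff_ae_le {X : Type*} [TopologicalSpace X] [T2Space X] [MeasureSpace X]
    [BorelSpace X] {v w : X → ℝ} (hw : Measurable w) (hpos : ∀ x, 0 < w x) (h : v =ᵐ[volume] w) :
    MemLocLp (fun x => (v x)⁻¹) ∞ ↔
      ∀ K : Set X, IsCompact K → ∃ a : ℝ, ∀ᵐ x, x ∈ K → (w x)⁻¹ ≤ a := by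
  refine forall₂_congr fun K hK => ?_
  have hae : (fun x => (v x)⁻¹) =ᵐ[volume.restrict K] fun x => (w x)⁻¹ :=
    ae_restrict_of_ae (h.mono fun x hx => by simp only [hx])
  rw [memLp_congr_ae hae]
  have hnorm : ∀ x, ‖(w x)⁻¹‖ = (w x)⁻¹ := fun x =>
    Real.norm_of_nonneg (inv_nonneg.2 (hpos x).le)
  constructor
  · intro hmem
    refine ⟨(eLpNorm (fun x => (w x)⁻¹) ∞ (volume.restrict K)).toReal, ?_⟩
    rw [← ae_restrict_iff' hK.measurableSet]
    filter_upwards [ae_le_eLpNormEssSup (f := fun x => (w x)⁻¹)] with x hx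
    rw [eLpNorm_exponent_top, ← hnorm, ← toReal_enorm]
    refine ENNReal.toReal_mono ?_ hx
    simpa [eLpNorm_exponent_top] using hmem.2.ne
  · rintro ⟨a, ha⟩
    refine memLp_top_of_bound hw.inv.aestronglyMeasurable a ?_
    rw [ae_restrict_iff' hK.measurableSet]
    simpa only [Pi.inv_apply, hnorm] using ha

theorem memLocLp_iff_memLp {X : Type*} [TopologicalSpace X] [CompactSpace X] [MeasureSpace X]
    {f : X → ℝ} {q : ℝ≥0∞} : MemLocLp f q ↔ MemLp f q volume :=
  ⟨fun h => by simpa using h univ isCompact_univ, fun h K _ => h.restrict K⟩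

namespace EuclideanCover

variable {X : Type*} [TopologicalSpace X] [T2Space X] [MeasureSpace X] [BorelSpace X]
variable {ι : Type*} [Fintype ι]

theorem memLocLp_rpow_iff (c : EuclideanCover X ι) {v : X → ℝ} (hv : IsPosWeight v) {p p' : ℝ}
    (hp : 1 < p) (hpp' : 1 / p + 1 / p' = 1) :
    MemLocLp (fun x => v x ^ (-(1 / p))) (ENNReal.ofReal p') ↔
      ∃ u : X → ℝ, IsPosWeight u ∧ MapsStrong c.maximal p v u := by
  obtain ⟨w, hw, hpos, hvw⟩ := hv.exists_measurable_pos
  simp only [memLocLp_rpow_iff_lintegral hw hpos hvw hp hpp', mapsStrong_congr_weight hvw]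
  exact ⟨c.exists_mapsStrong hw hpos hp, fun ⟨u, hu, hmaps⟩ K hK =>
    c.setLIntegral_rpow_lt_top_of_mapsStrong hw hpos hu hp hmaps hK⟩

/-- The mapping property without a bound already forces local boundedness of 1/v, which returns the
uniform bound, possibly for another u. -/
theorem memLocLp_inv_tfae (c : EuclideanCover X ι) {v : X → ℝ} (hv : IsPosWeight v) :
    List.TFAE [
      MemLocLp (fun x => (v x)⁻¹) ∞,
      ∃ u : X → ℝ, IsPosWeight u ∧ MapsIntoWeak c.maximal v u,
      ∃ u : X → ℝ, IsPosWeight u ∧ MapsWeakBounded c.maximal v u] := by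
  obtain ⟨w, hw, hpos, hvw⟩ := hv.exists_measurable_pos
  simp only [memLocLp_inv_iff_ae_le hw hpos hvw, mapsIntoWeak_congr_weight hvw,
    mapsWeakBounded_congr_weight hvw]
  tfae_have 1 → 3 := c.exists_mapsWeakBounded hw hpos
  tfae_have 3 → 2 := fun ⟨u, hu, hmaps⟩ => ⟨u, hu, hmaps.mapsIntoWeak⟩
  tfae_have 2 → 1 := fun ⟨u, hu, hmaps⟩ K hK => c.ae_inv_le_of_mapsIntoWeak hw hpos hu hmaps hK
  tfae_finish

end EuclideanCover

/-! ### The covers of the torus and of the waveguide. -/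

theorem coe_circleRep (x : UnitAddCircle) : (circleRep x : UnitAddCircle) = x :=
  AddCircle.coe_equivIco

theorem circleRep_mem (x : UnitAddCircle) : circleRep x ∈ Ico (-1 / 2 : ℝ) (1 / 2) := by
  have h : circleRep x ∈ Ico (-1 / 2 : ℝ) (-1 / 2 + 1) :=
    (AddCircle.equivIco (1 : ℝ) (-1 / 2) x).2
  norm_num at h ⊢
  exact h

theorem measurable_circleRep : Measurable circleRep :=
  measurable_subtype_coe.comp (AddCircle.measurableEquivIco 1 (-1 / 2)).measurable

theorem measurePreserving_circleRep :
    MeasurePreserving circleRep volume (volume.restrict (Ico (-1 / 2 : ℝ) (1 / 2))) := by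
  refine ⟨measurable_circleRep, ?_⟩
  have h := (UnitAddCircle.measurePreserving_mk (-1 / 2)).map_eq
  rw [show (-1 / 2 : ℝ) + 1 = 1 / 2 by norm_num,
    ← Measure.restrict_congr_set (μ := volume) Ico_ae_eq_Ioc] at h
  -- The circle measure is the image of Lebesgue measure on the interval, on which `circleRep`
  -- inverts the quotient map.
  rw [← h, Measure.map_map measurable_circleRep AddCircle.measurable_mk']
  conv_rhs => rw [← Measure.map_id (μ := volume.restrict (Ico (-1 / 2 : ℝ) (1 / 2)))]
  refine Measure.map_congr ?_
  filter_upwards [ae_restrict_mem measurableSet_Ico] with x hx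
  refine AddCircle.equivIco_coe_of_mem ?_
  norm_num at hx ⊢
  exact hx

/-- The interval is a union of two fundamental domains; this is the source of the multiplicity 2^n.
-/
theorem measurePreserving_circle_mk_two :
    MeasurePreserving ((↑) : ℝ → UnitAddCircle) (volume.restrict (Ioc (-1 : ℝ) 1))
      ((2 : ℝ≥0∞) • volume) := by
  refine ⟨AddCircle.measurable_mk', ?_⟩
  have h1 := (UnitAddCircle.measurePreserving_mk (-1)).map_eq
  have h2 := (UnitAddCircle.measurePreserving_mk 0).map_eq
  norm_num at h1 h2
  rw [← Ioc_union_Ioc_eq_Ioc (show (-1 : ℝ) ≤ 0 by norm_num) zero_le_one,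
    Measure.restrict_union (Ioc_disjoint_Ioc_of_le le_rfl) measurableSet_Ioc,
    Measure.map_add _ _ AddCircle.measurable_mk', h1, h2, two_smul]

theorem measurePreserving_circleRep_pi (n : ℕ) :
    MeasurePreserving (fun (x : UnitAddTorus (Fin n)) i => circleRep (x i)) volume
      (volume.restrict (univ.pi fun _ => Ico (-1 / 2 : ℝ) (1 / 2))) := by
  rw [volume_pi, volume_pi, Measure.restrict_pi_pi]
  exact measurePreserving_pi _ _ fun _ => measurePreserving_circleRep

theorem measurePreserving_torus_mk_two (n : ℕ) :
    MeasurePreserving (fun (z : Fin n → ℝ) i => (z i : UnitAddCircle))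
      (volume.restrict (univ.pi fun _ => Ioc (-1 : ℝ) 1))
      (((2 : ℝ≥0) ^ n : ℝ≥0) • (volume : Measure (UnitAddTorus (Fin n)))) := by
  have : IsFiniteMeasure ((2 : ℝ≥0∞) • (volume : Measure UnitAddCircle)) :=
    ⟨by simp⟩
  have h : (((2 : ℝ≥0) ^ n : ℝ≥0) • (volume : Measure (UnitAddTorus (Fin n)))) =
      Measure.pi fun _ => (2 : ℝ≥0∞) • volume := by
    refine (Measure.pi_eq fun s _ => ?_).symm
    simp [Measure.smul_apply, volume_pi_pi, Finset.prod_mul_distrib, ENNReal.smul_def]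
  rw [h, volume_pi, Measure.restrict_pi_pi]
  exact measurePreserving_pi _ _ fun _ => measurePreserving_circle_mk_two

theorem EuclideanSpace.abs_apply_sub_lt {ι : Type*} [Fintype ι] {y z : EuclideanSpace ℝ ι} {r : ℝ}
    (h : y ∈ Metric.ball z r) (i : ι) : |y i - z i| < r := by
  rw [mem_ball_iff_norm] at h
  exact (PiLp.norm_apply_le (y - z) i).trans_lt h

theorem mem_Ioc_of_mem_Ico_of_abs_sub_lt {y z : ℝ} (hz : z ∈ Ico (-1 / 2 : ℝ) (1 / 2))
    (h : |y - z| < 1 / 2) : y ∈ Ioc (-1 : ℝ) 1 := by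
  obtain ⟨h1, h2⟩ := abs_lt.1 h
  exact ⟨by linarith [hz.1], by linarith [hz.2]⟩

/-- The torus covered by Euclidean space. -/
noncomputable def torusCover (n : ℕ) : EuclideanCover (UnitAddTorus (Fin n)) (Fin n) where
  proj z i := (z i : UnitAddCircle)
  lift x := WithLp.toLp 2 fun i => circleRep (x i)
  dom := WithLp.ofLp ⁻¹' univ.pi fun _ => Ico (-1 / 2 : ℝ) (1 / 2)
  region := WithLp.ofLp ⁻¹' univ.pi fun _ => Ioc (-1 : ℝ) 1
  multiplicity := 2 ^ n
  continuous_proj := continuous_pi fun i =>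
    (AddCircle.continuous_mk' 1).comp (by fun_prop : Continuous fun z : EuclideanSpace ℝ _ => z i)
  proj_lift x := funext fun i => coe_circleRep (x i)
  measurableSet_dom := (PiLp.volume_preserving_ofLp (Fin n)).measurable
    (MeasurableSet.univ_pi fun _ => measurableSet_Ico)
  measurePreserving_lift :=
    ((PiLp.volume_preserving_toLp (Fin n)).restrict_preimage
      ((PiLp.volume_preserving_ofLp (Fin n)).measurable
        (MeasurableSet.univ_pi fun _ => measurableSet_Ico))).comp (measurePreserving_circleRep_pi n)
  lift_mem x := fun i _ => circleRep_mem (x i)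
  ball_subset z hz y hy := fun i hi => mem_Ioc_of_mem_Ico_of_abs_sub_lt (hz i hi)
    (EuclideanSpace.abs_apply_sub_lt hy i)
  measurableSet_region := (PiLp.volume_preserving_ofLp (Fin n)).measurable
    (MeasurableSet.univ_pi fun _ => measurableSet_Ioc)
  map_proj_le := ((measurePreserving_torus_mk_two n).comp
    ((PiLp.volume_preserving_ofLp (Fin n)).restrict_preimage
      (MeasurableSet.univ_pi fun _ => measurableSet_Ioc))).map_eq.le
  isBounded_lift K _ := by
    have hc : IsCompact (WithLp.toLp 2 '' univ.pi fun _ : Fin n => Icc (-1 / 2 : ℝ) (1 / 2)) :=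
      (isCompact_univ_pi fun _ => isCompact_Icc).image (PiLp.continuous_toLp 2 _)
    refine hc.isBounded.subset ?_
    rintro _ ⟨x, -, rfl⟩
    exact mem_image_of_mem _ fun i _ => Ico_subset_Icc_self (circleRep_mem (x i))

theorem measurePreserving_euclidean_sumEquiv (n m : ℕ) :
    MeasurePreserving (fun z : EuclideanSpace ℝ (Fin n ⊕ Fin m) =>
      ((fun i => z (Sum.inl i), fun j => z (Sum.inr j)) : (Fin n → ℝ) × (Fin m → ℝ))) :=
  (volume_measurePreserving_sumPiEquivProdPi fun _ : Fin n ⊕ Fin m => ℝ).comp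
    (PiLp.volume_preserving_ofLp (Fin n ⊕ Fin m))

theorem measurePreserving_euclidean_sumEquiv_symm (n m : ℕ) :
    MeasurePreserving (fun w : (Fin n → ℝ) × (Fin m → ℝ) =>
      (WithLp.toLp 2 (Sum.elim w.1 w.2) : EuclideanSpace ℝ (Fin n ⊕ Fin m))) := by
  convert! (PiLp.volume_preserving_toLp (Fin n ⊕ Fin m)).comp
    (volume_measurePreserving_sumPiEquivProdPi_symm fun _ : Fin n ⊕ Fin m => ℝ) using 1

/-- The waveguide manifold covered by Euclidean space. -/
noncomputable def waveguideCover (n m : ℕ) : EuclideanCover (Waveguide n m) (Fin n ⊕ Fin m) where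
  proj z := (fun i => (z (Sum.inl i) : UnitAddCircle), WithLp.toLp 2 fun j => z (Sum.inr j))
  lift x := WithLp.toLp 2 (Sum.elim (fun i => circleRep (x.1 i)) fun j => x.2 j)
  dom := (fun z => ((fun i => z (Sum.inl i), fun j => z (Sum.inr j)) :
    (Fin n → ℝ) × (Fin m → ℝ))) ⁻¹' ((univ.pi fun _ => Ico (-1 / 2 : ℝ) (1 / 2)) ×ˢ univ)
  region := (fun z => ((fun i => z (Sum.inl i), fun j => z (Sum.inr j)) :
    (Fin n → ℝ) × (Fin m → ℝ))) ⁻¹' ((univ.pi fun _ => Ioc (-1 : ℝ) 1) ×ˢ univ)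
  multiplicity := 2 ^ n
  continuous_proj := by
    refine .prodMk (continuous_pi fun i => (AddCircle.continuous_mk' 1).comp
      (by fun_prop : Continuous fun z : EuclideanSpace ℝ _ => z (Sum.inl i))) ?_
    fun_prop
  proj_lift x := Prod.ext (funext fun i => coe_circleRep (x.1 i)) rfl
  measurableSet_dom := (measurePreserving_euclidean_sumEquiv n m).measurable
    ((MeasurableSet.univ_pi fun _ => measurableSet_Ico).prod MeasurableSet.univ)
  measurePreserving_lift := by
    have h1 := (measurePreserving_circleRep_pi n).prod (PiLp.volume_preserving_ofLp (Fin m))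
    rw [← Measure.restrict_univ (μ := (volume : Measure (Fin m → ℝ))), Measure.prod_restrict] at h1
    exact ((measurePreserving_euclidean_sumEquiv_symm n m).restrict_preimage
      ((measurePreserving_euclidean_sumEquiv n m).measurable
        ((MeasurableSet.univ_pi fun _ => measurableSet_Ico).prod MeasurableSet.univ))).comp h1
  lift_mem x := ⟨fun i _ => circleRep_mem (x.1 i), mem_univ _⟩
  ball_subset z hz y hy := ⟨fun i hi => mem_Ioc_of_mem_Ico_of_abs_sub_lt (hz.1 i hi)
    (EuclideanSpace.abs_apply_sub_lt hy (Sum.inl i)), mem_univ _⟩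
  measurableSet_region := (measurePreserving_euclidean_sumEquiv n m).measurable
    ((MeasurableSet.univ_pi fun _ => measurableSet_Ioc).prod MeasurableSet.univ)
  map_proj_le := by
    have h1 := (measurePreserving_torus_mk_two n).prod (PiLp.volume_preserving_toLp (Fin m))
    rw [← Measure.restrict_univ (μ := (volume : Measure (Fin m → ℝ))), Measure.prod_restrict] at h1
    refine (h1.comp ((measurePreserving_euclidean_sumEquiv n m).restrict_preimage
      ((MeasurableSet.univ_pi fun _ => measurableSet_Ioc).prod MeasurableSet.univ))).map_eq.le.trans ?_
    exact (Measure.prod_smul_left _).le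
  isBounded_lift K hK := by
    -- The lift need not be continuous, so its image of K is enclosed in a compact set: a cube in
    -- the periodic directions, the projection of K in the others.
    have hc : IsCompact ((fun w : (Fin n → ℝ) × EuclideanSpace ℝ (Fin m) =>
        (WithLp.toLp 2 (Sum.elim w.1 w.2.ofLp) : EuclideanSpace ℝ (Fin n ⊕ Fin m))) ''
        ((univ.pi fun _ => Icc (-1 / 2 : ℝ) (1 / 2)) ×ˢ (Prod.snd '' K))) := by
      refine ((isCompact_univ_pi fun _ => isCompact_Icc).prod (hK.image continuous_snd)).image ?_
      refine (PiLp.continuous_toLp 2 _).comp (continuous_pi fun i => ?_)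
      cases i
      · simp only [Sum.elim_inl]; fun_prop
      · simp only [Sum.elim_inr]; fun_prop
    refine hc.isBounded.subset ?_
    rintro _ ⟨x, hx, rfl⟩
    exact ⟨(fun i => circleRep (x.1 i), x.2),
      ⟨fun i _ => Ico_subset_Icc_self (circleRep_mem (x.1 i)), mem_image_of_mem _ hx⟩, rfl⟩

/-! ### Conclusion. -/

theorem torusCover_maximal (n : ℕ) : (torusCover n).maximal = torusMaximal n := rfl

theorem waveguideCover_maximal (n m : ℕ) : (waveguideCover n m).maximal = waveguideMaximal n m :=
  rfl

theorem proposition3p3 :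
    (∀ (n : ℕ) (v : UnitAddTorus (Fin n) → ℝ), IsPosWeight v →
      (∀ p p' : ℝ, 1 < p → 1 / p + 1 / p' = 1 →
        (MemLp (fun x => v x ^ (-(1 / p))) (ENNReal.ofReal p') volume ↔
          ∃ u : UnitAddTorus (Fin n) → ℝ, IsPosWeight u ∧ MapsStrong (torusMaximal n) p v u)) ∧
      List.TFAE [
        MemLp (fun x => (v x)⁻¹) ∞ volume,
        ∃ u : UnitAddTorus (Fin n) → ℝ, IsPosWeight u ∧ MapsIntoWeak (torusMaximal n) v u,
        ∃ u : UnitAddTorus (Fin n) → ℝ, IsPosWeight u ∧ MapsWeakBounded (torusMaximal n) v u]) ∧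
    (∀ (n m : ℕ) (v : Waveguide n m → ℝ), IsPosWeight v →
      (∀ p p' : ℝ, 1 < p → 1 / p + 1 / p' = 1 →
        (MemLocLp (fun z => v z ^ (-(1 / p))) (ENNReal.ofReal p') ↔
          ∃ u : Waveguide n m → ℝ, IsPosWeight u ∧ MapsStrong (waveguideMaximal n m) p v u)) ∧
      List.TFAE [
        MemLocLp (fun z => (v z)⁻¹) ∞,
        ∃ u : Waveguide n m → ℝ, IsPosWeight u ∧ MapsIntoWeak (waveguideMaximal n m) v u,
        ∃ u : Waveguide n m → ℝ, IsPosWeight u ∧ MapsWeakBounded (waveguideMaximal n m) v u]) := by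
  refine ⟨fun n v hv => ⟨fun p p' hp hpp' => ?_, ?_⟩,
    fun n m v hv => ⟨fun p p' hp hpp' => ?_, ?_⟩⟩
  · rw [← memLocLp_iff_memLp, ← torusCover_maximal]
    exact (torusCover n).memLocLp_rpow_iff hv hp hpp'
  · rw [← memLocLp_iff_memLp, ← torusCover_maximal]
    exact (torusCover n).memLocLp_inv_tfae hv
  · rw [← waveguideCover_maximal]
    exact (waveguideCover n m).memLocLp_rpow_iff hv hp hpp'
  · rw [← waveguideCover_maximal]
    exact (waveguideCover n m).memLocLp_inv_tfae hv
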